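/- Let $\mathbf{k}=\mathbb{F}_q$ be a finite field, $\mathbf{v}=\sqrt q$, and $\Lambda^\imath=\mathbf{k}[x]/(x^2)$, the $\imath$quiver algebra of the split $\imath$quiver with one vertex and no arrows. Let $S=\Lambda^\imath/(x)$ be the simple module, $\mathbb{K}=\Lambda^\imath$ the regular module, and $mS=S^{\oplus m}$. For finite-dimensional $\Lambda^\imath$-modules $M,N,L$, let $\mathrm{Ext}^1(M,N)_L\subseteq\mathrm{Ext}^1_{\Lambda^\imath}(M,N)$ be the set of classes of short exact sequences $0\to N\to L'\to M\to 0$ with $L'\cong L$. The twisted Hall algebra of $\Lambda^\imath$ is the $\mathbb{Q}(\mathbf{v})$-vector space with basis the isomorphism classes $[M]$ of finite-dimensional $\Lambda^\imath$-modules and product $$[M]*[N]=\mathbf{v}^{\langle M,N\rangle}\sum_{[L]}\frac{|\mathrm{Ext}^1(M,N)_L|}{|\mathrm{Hom}_{\Lambda^\imath}(M,N)|}\,[L],\qquad \langle M,N\rangle=\dim_{\mathbf{k}}M\cdot\dim_{\mathbf{k}}N .$$ The $\imath$Hall algebra $\widetilde{\mathcal H}$ is obtained from it by dividing out the two-sided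 ideal generated by the elements $[K]-[K']$ (for $K\cong K'$ of projective dimension $\le 1$) and $[L]-[K\oplus M]$ (for each short exact sequence $0\to K\to L\to M\to 0$ with $K$ of projective dimension $\le1$), and then localizing at the multiplicative set generated by the images of the elements $a[K]$ with $a\in\mathbb{Q}^\times$ and $K$ of projective dimension $\le1$. We write $[M]$ also for the image of $[M]$ in $\widetilde{\mathcal H}$. All products and powers below are taken with respect to $*$. Put $[n]=\frac{\mathbf{v}^n-\mathbf{v}^{-n}}{\mathbf{v}-\mathbf{v}^{-1}}$, $[n]!=[1][2]\cdots[n]$ with $[0]!=1$, and $[2k]!!=[2][4]\cdots[2k]$ with $[0]!!=1$. The $\imath$divided powers of $[S]$ are $$[S]^{(m)}_{\bar 1}=\frac1{[m]!}\begin{cases}[S]\prod_{j=1}^{k}\bigl([S]^2+\mathbf{v}^{-1}(\mathbf{v}^2-1)^2[2j-1]^2[\mathbb{K}]\bigr)& m=2k+1,\\ \prod_{j=1}^{k}\bigl([S]^2+\mathbf{v}^{-1}(\mathbf{v}^2-1)^2[2j-1]^2[\mathbb{K}]\bigr)& m=2k,\end{cases}$$ $$[S]^{(m)}_{\bar 0}=\frac1{[m]!}\begin{cases}[S]\prod_{j=1}^{k}\bigl([S]^2+\mathbf{v}^{-1}(\mathbf{v}^2-1)^2[2j]^2[\mathbb{K}]\bigr)&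 m=2k+1,\\ \prod_{j=1}^{k}\bigl([S]^2+\mathbf{v}^{-1}(\mathbf{v}^2-1)^2[2j-2]^2[\mathbb{K}]\bigr)& m=2k.\end{cases}$$ **Proposition.** For every $n\in\mathbb{N}=\{0,1,2,\dots\}$ the following two identities hold in $\widetilde{\mathcal H}$: $$[S]^{(n)}_{\bar 0}=\sum_{k=0}^{\lfloor n/2\rfloor}\frac{\mathbf{v}^{k(k-(-1)^n)-\binom{n-2k}{2}}\,(\mathbf{v}-\mathbf{v}^{-1})^k}{[n-2k]!\,[2k]!!}\,[(n-2k)S]*[\mathbb{K}]^k,$$ $$[S]^{(n)}_{\bar 1}=\sum_{k=0}^{\lfloor n/2\rfloor}\frac{\mathbf{v}^{k(k+(-1)^n)-\binom{n-2k}{2}}\,(\mathbf{v}-\mathbf{v}^{-1})^k}{[n-2k]!\,[2k]!!}\,[(n-2k)S]*[\mathbb{K}]^k.$$ -/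

import Mathlib

universe u
open CategoryTheory

namespace IHall

section Counting

variable (R : Type u) [CommRing R]
variable (A B C D M N L : Type u) [AddCommGroup A] [Module R A] [AddCommGroup B] [Module R B]
  [AddCommGroup C] [Module R C] [AddCommGroup D] [Module R D] [AddCommGroup L] [Module R L]
  [AddCommGroup M] [Module R M] [AddCommGroup N] [Module R N]

/-- The pairs of maps `N → L → M` forming a short exact sequence `0 → N → L → M → 0`. -/
def ExactPair : Type u :=
  {p : (N →ₗ[R] L) × (L →ₗ[R] M) //
    Function.Injective p.1 ∧ Function.Surjective p.2 ∧ Function.Exact p.1 p.2}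

/-- Auxiliary two-step filtrations, used for associativity. -/
def Flag : Type u :=
  {t : (C →ₗ[R] D) × (Σ p : D →ₗ[R] A, LinearMap.ker p →ₗ[R] B) //
    Function.Injective t.1 ∧ Function.Surjective t.2.1 ∧ Function.Surjective t.2.2 ∧
    (∀ c, t.2.1 (t.1 c) = 0) ∧ ∀ x : LinearMap.ker t.2.1, t.2.2 x = 0 ↔ ∃ c, t.1 c = x}

instance [Finite M] [Finite N] : Finite (M →ₗ[R] N) :=
  Finite.of_injective (fun f => (f : M → N)) DFunLike.coe_injective

instance [Finite M] [Finite N] [Finite L] : Finite (ExactPair R M N L) := by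
  unfold ExactPair; infer_instance

instance [Finite M] [Finite N] : Finite (M ≃ₗ[R] N) :=
  Finite.of_injective (fun f => (f : M → N)) DFunLike.coe_injective

instance [Finite A] [Finite B] [Finite C] [Finite D] : Finite (Flag R A B C D) := by
  unfold Flag; infer_instance

variable {R A B C D L M N}

theorem lift_surj {X Y Z : Type u} [AddCommGroup X] [Module R X] [AddCommGroup Y] [Module R Y]
    [AddCommGroup Z] [Module R Z] (s : X →ₗ[R] Y) (hs : Function.Surjective s) (f : X →ₗ[R] Z)
    (h : ∀ x, s x = 0 → f x = 0) : ∃ g : Y →ₗ[R] Z, ∀ x, g (s x) = f x := by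
  refine ⟨(Submodule.liftQ _ f (fun x hx => h x hx)) ∘ₗ
    (s.quotKerEquivOfSurjective hs).symm.toLinearMap, fun x => ?_⟩
  have : (s.quotKerEquivOfSurjective hs).symm (s x) = Submodule.Quotient.mk x := by
    rw [LinearEquiv.symm_apply_eq]; rfl
  rw [LinearMap.comp_apply, LinearEquiv.coe_coe, this]; rfl

theorem lift_inj {X Y Z : Type u} [AddCommGroup X] [Module R X] [AddCommGroup Y] [Module R Y]
    [AddCommGroup Z] [Module R Z] (j : X →ₗ[R] Y) (hj : Function.Injective j) (f : Z →ₗ[R] Y)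
    (h : ∀ z, ∃ x, j x = f z) : ∃ g : Z →ₗ[R] X, ∀ z, j (g z) = f z := by
  refine ⟨(LinearEquiv.ofInjective j hj).symm.toLinearMap ∘ₗ f.codRestrict (LinearMap.range j)
    (fun z => h z), fun z => ?_⟩
  have := (LinearEquiv.ofInjective j hj).apply_symm_apply
    (f.codRestrict (LinearMap.range j) (fun z => h z) z)
  exact congrArg Subtype.val this

theorem card_left [Finite A] [Finite B] [Finite C] [Finite D] [Finite L] :
    Nat.card (ExactPair R A B L × ExactPair R L C D) =
      Nat.card (Σ t : Flag R A B C D, (D ⧸ LinearMap.range t.1.1) ≃ₗ[R] L) := by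
  symm
  have H : ∀ te : (Σ t : Flag R A B C D, (D ⧸ LinearMap.range t.1.1) ≃ₗ[R] L),
      ∃ x : ExactPair R A B L × ExactPair R L C D,
        x.2.1.1 = te.1.1.1 ∧ (∀ d, x.2.1.2 d = te.2 (Submodule.Quotient.mk d)) ∧
        (∀ d, x.1.1.2 (x.2.1.2 d) = te.1.1.2.1 d) ∧
        ∀ d, x.1.1.1 (te.1.1.2.2 d) = x.2.1.2 d.1 := by
    rintro ⟨⟨⟨i, p, β⟩, hi, hp, hβ, hpi, hex⟩, e⟩
    dsimp only at *
    set r : D →ₗ[R] L := e.toLinearMap ∘ₗ (LinearMap.range i).mkQ with hr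
    have hrs : Function.Surjective r := e.surjective.comp (Submodule.mkQ_surjective _)
    have hr0 : ∀ d, r d = 0 ↔ ∃ c, i c = d := by
      intro d; simp [hr]
    obtain ⟨b, hb⟩ := lift_surj r hrs p (by
      intro d hd; obtain ⟨c, rfl⟩ := (hr0 d).1 hd; exact hpi c)
    obtain ⟨a, ha⟩ := lift_surj β hβ (r ∘ₗ (LinearMap.ker p).subtype) (by
      intro d hd; exact (hr0 _).2 ((hex d).1 hd))
    refine ⟨⟨⟨(a, b), ?_, ?_, ?_⟩, ⟨(i, r), hi, hrs, ?_⟩⟩, rfl, fun d => rfl, hb, ha⟩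
    · rw [injective_iff_map_eq_zero]
      intro y hy
      obtain ⟨d, rfl⟩ := hβ y
      rw [ha] at hy
      exact (hex d).2 ((hr0 _).1 hy)
    · intro y; obtain ⟨d, rfl⟩ := hp y; exact ⟨r d, hb d⟩
    · intro l
      obtain ⟨d, rfl⟩ := hrs l
      dsimp only
      rw [hb]
      constructor
      · intro hd; exact ⟨β ⟨d, hd⟩, ha _⟩
      · rintro ⟨y, hy⟩
        obtain ⟨d', rfl⟩ := hβ y
        rw [ha] at hy
        rw [← hb, ← hy]; simp [hb]
    · intro d; exact hr0 d
  choose φ h1 h2 h3 h4 using H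
  refine Nat.card_congr (Equiv.ofBijective φ ⟨?_, ?_⟩)
  · intro te te' hh
    have k1 := h1 te; have k2 := h2 te; have k3 := h3 te; have k4 := h4 te
    have k1' := h1 te'; have k2' := h2 te'; have k3' := h3 te'; have k4' := h4 te'
    rw [← hh] at k1' k2' k3' k4'
    generalize φ te = x at *
    obtain ⟨⟨⟨i, p, β⟩, ht⟩, e⟩ := te
    obtain ⟨⟨⟨i', p', β'⟩, ht'⟩, e'⟩ := te'
    dsimp only at *
    obtain rfl : i = i' := k1.symm.trans k1'
    obtain rfl : p = p' := by ext d; rw [← k3, ← k3']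
    obtain rfl : β = β' := by
      ext d; apply x.1.2.1; rw [k4, k4']
    congr 1
    ext d
    obtain ⟨d, rfl⟩ := Submodule.Quotient.mk_surjective _ d
    rw [← k2, ← k2']
  · rintro ⟨⟨⟨a, b⟩, ha, hb, hab⟩, ⟨⟨i, r⟩, hi, hr, hir⟩⟩
    dsimp only at ha hb hab hi hr hir
    obtain ⟨β, hβ⟩ := lift_inj a ha (r ∘ₗ (LinearMap.ker (b ∘ₗ r)).subtype) (by
      intro z; exact (hab _).1 z.2)
    have hker : LinearMap.range i = LinearMap.ker r := by
      ext d; exact (hir d).symm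
    let e : (D ⧸ LinearMap.range i) ≃ₗ[R] L :=
      (Submodule.quotEquivOfEq _ _ hker).trans (r.quotKerEquivOfSurjective hr)
    have he : ∀ d, e (Submodule.Quotient.mk d) = r d := fun d => rfl
    have hβs : Function.Surjective β := by
      intro y
      obtain ⟨d, hd⟩ := hr (a y)
      have hd' : d ∈ LinearMap.ker (b ∘ₗ r) := by
        simp only [LinearMap.mem_ker, LinearMap.comp_apply, hd]
        exact (hab _).2 ⟨y, rfl⟩
      refine ⟨⟨d, hd'⟩, ha ?_⟩
      rw [hβ]; exact hd
    let t : Flag R A B C D := ⟨(i, ⟨b ∘ₗ r, β⟩), hi, hb.comp hr, hβs, by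
      intro c; simp [(hir (i c)).2 ⟨c, rfl⟩], by
      intro x
      dsimp only
      rw [← map_eq_zero_iff a ha, hβ]
      exact hir x.1⟩
    refine ⟨⟨t, e⟩, ?_⟩
    have k1 := h1 ⟨t, e⟩; have k2 := h2 ⟨t, e⟩; have k3 := h3 ⟨t, e⟩; have k4 := h4 ⟨t, e⟩
    generalize φ ⟨t, e⟩ = x at *
    obtain ⟨⟨⟨a', b'⟩, ha'⟩, ⟨⟨i', r'⟩, hi'⟩⟩ := x
    dsimp only at k1 k2 k3 k4
    have k5 : r' = r := by ext d; exact (k2 d).trans (he d)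
    subst k5
    have k6 : b' = b := by
      ext l; obtain ⟨d, rfl⟩ := hr l; exact k3 d
    have k7 : a' = a := by
      ext y; obtain ⟨d, rfl⟩ := hβs y; exact (k4 d).trans (hβ d).symm
    subst k6 k7 k1
    rfl

theorem card_right [Finite A] [Finite B] [Finite C] [Finite D] [Finite L] :
    Nat.card (ExactPair R B C L × ExactPair R A L D) =
      Nat.card (Σ t : Flag R A B C D, LinearMap.ker t.1.2.1 ≃ₗ[R] L) := by
  symm
  have H : ∀ te : (Σ t : Flag R A B C D, LinearMap.ker t.1.2.1 ≃ₗ[R] L),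
      ∃ x : ExactPair R B C L × ExactPair R A L D,
        x.2.1.2 = te.1.1.2.1 ∧ (∀ d, x.2.1.1 (te.2 d) = d.1) ∧
        (∀ c, x.2.1.1 (x.1.1.1 c) = te.1.1.1 c) ∧
        ∀ d, x.1.1.2 (te.2 d) = te.1.1.2.2 d := by
    rintro ⟨⟨⟨i, p, β⟩, hi, hp, hβ, hpi, hex⟩, e⟩
    change LinearMap.ker p ≃ₗ[R] L at e
    replace hi : Function.Injective i := hi
    replace hpi : ∀ c, i c ∈ LinearMap.ker p := hpi
    replace hex : ∀ x : LinearMap.ker p, β x = 0 ↔ ∃ c, i c = x := hex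
    refine ⟨⟨⟨(e.toLinearMap ∘ₗ i.codRestrict (LinearMap.ker p) hpi, β ∘ₗ e.symm.toLinearMap),
      ?_, ?_, ?_⟩, ⟨((LinearMap.ker p).subtype ∘ₗ e.symm.toLinearMap, p), ?_, hp, ?_⟩⟩, rfl,
      ?_, ?_, ?_⟩
    · intro c c' h
      have := e.injective h
      exact hi (congrArg Subtype.val this)
    · exact hβ.comp e.symm.surjective
    · intro l
      obtain ⟨d, rfl⟩ := e.surjective l
      simp only [LinearMap.comp_apply, LinearEquiv.coe_coe, LinearEquiv.symm_apply_apply, hex]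
      refine exists_congr fun c => ?_
      have h1 : (i.codRestrict (LinearMap.ker p) hpi c = d) ↔ i c = d.1 := Subtype.ext_iff
      exact h1.symm.trans e.injective.eq_iff.symm
    · exact Subtype.val_injective.comp e.symm.injective
    · intro d
      constructor
      · intro hd; exact ⟨e ⟨d, hd⟩, by simp⟩
      · rintro ⟨l, rfl⟩; exact (e.symm l).2
    · intro d; simp
    · intro c
      exact congrArg Subtype.val (e.symm_apply_apply (i.codRestrict (LinearMap.ker p) hpi c))
    · intro d; simp
  choose φ h1 h2 h3 h4 using H
  refine Nat.card_congr (Equiv.ofBijective φ ⟨?_, ?_⟩)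
  · intro te te' hh
    have k1 := h1 te; have k2 := h2 te; have k3 := h3 te; have k4 := h4 te
    have k1' := h1 te'; have k2' := h2 te'; have k3' := h3 te'; have k4' := h4 te'
    rw [← hh] at k1' k2' k3' k4'
    generalize φ te = x at *
    obtain ⟨⟨⟨i, p, β⟩, ht⟩, e⟩ := te
    obtain ⟨⟨⟨i', p', β'⟩, ht'⟩, e'⟩ := te'
    dsimp only at *
    obtain rfl : p = p' := k1.symm.trans k1'
    obtain rfl : i = i' := by ext c; rw [← k3, ← k3']
    obtain rfl : e = e' := by ext d; apply x.2.2.1; rw [k2, k2']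
    obtain rfl : β = β' := by ext d; rw [← k4, ← k4']
    rfl
  · rintro ⟨⟨⟨c, s⟩, hc, hs, hcs⟩, ⟨⟨j, p⟩, hj, hp, hjp⟩⟩
    dsimp only at hc hs hcs hj hp hjp
    have hker : LinearMap.range j = LinearMap.ker p := by
      ext d; exact (hjp d).symm
    let e : LinearMap.ker p ≃ₗ[R] L :=
      (LinearEquiv.ofEq _ _ hker.symm).trans (LinearEquiv.ofInjective j hj).symm
    have he : ∀ d, j (e d) = d.1 := by
      intro d
      have := (LinearEquiv.ofInjective j hj).apply_symm_apply (LinearEquiv.ofEq _ _ hker.symm d)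
      exact congrArg Subtype.val this
    let t : Flag R A B C D := ⟨(j ∘ₗ c, ⟨p, s ∘ₗ e.toLinearMap⟩), hj.comp hc, hp,
      hs.comp e.surjective, fun x => (hjp _).2 ⟨c x, rfl⟩, by
      intro x
      refine (hcs (e x)).trans (exists_congr fun y => ?_)
      rw [← hj.eq_iff, he]; rfl⟩
    refine ⟨⟨t, e⟩, ?_⟩
    have k1 := h1 ⟨t, e⟩; have k2 := h2 ⟨t, e⟩; have k3 := h3 ⟨t, e⟩; have k4 := h4 ⟨t, e⟩
    generalize φ ⟨t, e⟩ = x at k1 k2 k3 k4 ⊢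
    obtain ⟨⟨⟨c', s'⟩, hc'⟩, ⟨⟨j', p'⟩, hj'⟩⟩ := x
    dsimp only at k1 k2 k3 k4
    have k5 : j' = j := by
      ext l; obtain ⟨d, rfl⟩ := e.surjective l; exact (k2 d).trans (he d).symm
    subst k5
    have k6 : s' = s := by
      ext l; obtain ⟨d, rfl⟩ := e.surjective l; exact k4 d
    have k7 : c' = c := by
      ext y; apply hj; exact k3 y
    subst k6 k7 k1
    rfl

open Classical in
theorem card_linearEquiv [Finite M] [Finite N] :
    Nat.card (M ≃ₗ[R] N) = if Nonempty (M ≃ₗ[R] N) then Nat.card (N ≃ₗ[R] N) else 0 := by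
  split_ifs with h
  · obtain ⟨e⟩ := h
    exact Nat.card_congr
      ⟨fun f => e.symm.trans f, fun f => e.trans f, fun f => by ext; simp, fun f => by ext; simp⟩
  · rw [not_nonempty_iff] at h
    exact Nat.card_of_isEmpty

theorem card_exactPair_congr {M' N' L' : Type u} [AddCommGroup M'] [Module R M']
    [AddCommGroup N'] [Module R N'] [AddCommGroup L'] [Module R L']
    (eM : M ≃ₗ[R] M') (eN : N ≃ₗ[R] N') (eL : L ≃ₗ[R] L') :
    Nat.card (ExactPair R M N L) = Nat.card (ExactPair R M' N' L') := by
  refine Nat.card_congr (Equiv.subtypeEquiv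
    (Equiv.prodCongr (eN.arrowCongr eL).toEquiv (eL.arrowCongr eM).toEquiv) ?_)
  rintro ⟨f, g⟩
  refine and_congr ?_ (and_congr ?_ ?_)
  · show _ ↔ Function.Injective (eL ∘ f ∘ eN.symm)
    simp
  · show _ ↔ Function.Surjective (eM ∘ g ∘ eL.symm)
    simp
  · show _ ↔ Function.Exact (eL ∘ f ∘ eN.symm) (eM ∘ g ∘ eL.symm)
    constructor
    · intro h l
      have := h (eL.symm l)
      simp only [Function.comp_apply, map_eq_zero_iff eM eM.injective, this]
      constructor
      · rintro ⟨n, hn⟩; exact ⟨eN n, by simp [hn]⟩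
      · rintro ⟨n, hn⟩; exact ⟨eN.symm n, by simp [← hn]⟩
    · intro h l
      have := h (eL l)
      simp only [Function.comp_apply, map_eq_zero_iff eM eM.injective,
        LinearEquiv.symm_apply_apply] at this
      rw [this]
      constructor
      · rintro ⟨n, hn⟩; exact ⟨eN.symm n, eL.injective hn⟩
      · rintro ⟨n, hn⟩; exact ⟨eN n, by simp [hn]⟩

theorem card_of_exactPair (x : ExactPair R M N L) [Finite L] :
    Nat.card L = Nat.card M * Nat.card N := by
  obtain ⟨⟨f, g⟩, hf, hg, h⟩ := x
  dsimp only at *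
  have hk : LinearMap.ker g = LinearMap.range f := by ext d; exact h d
  rw [Submodule.card_eq_card_quotient_mul_card (LinearMap.ker g),
    Nat.card_congr (g.quotKerEquivOfSurjective hg).toEquiv, hk,
    Nat.card_congr (LinearEquiv.ofInjective f hf).toEquiv, mul_comm]

end Counting
section Riedtmann

open Abelian

variable {R : Type u} [CommRing R]

/-- `Ext¹(M,N)_L`: the classes in `Ext¹(M,N)` of the short exact sequences
`0 → N → L → M → 0` with middle term `L`. -/
def extMiddle (M N L : ModuleCat.{u} R) : Set (Ext.{u} M N 1) :=
  {e | ∃ (f : N ⟶ L) (g : L ⟶ M) (w : f ≫ g = 0) (h : (ShortComplex.mk f g w).ShortExact),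
    h.extClass = e}

variable {M N L : ModuleCat.{u} R}

/-- The short complex of an exact pair. -/
abbrev ExactPair.complex (x : ExactPair R M N L) : ShortComplex (ModuleCat.{u} R) :=
  ShortComplex.mk (X₁ := N) (X₂ := L) (X₃ := M) (ModuleCat.ofHom x.1.1) (ModuleCat.ofHom x.1.2)
    (by ext n; exact (x.2.2.2 _).2 ⟨n, rfl⟩)

theorem ExactPair.shortExact (x : ExactPair R M N L) : x.complex.ShortExact :=
  ModuleCat.shortComplex_shortExact _ x.2.2.2 x.2.1 x.2.2.1

/-- The class of an exact pair. -/
noncomputable def ExactPair.cls (x : ExactPair R M N L) : Ext.{u} M N 1 := x.shortExact.extClass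

theorem mem_extMiddle_iff (e : Ext.{u} M N 1) :
    e ∈ extMiddle M N L ↔ ∃ x : ExactPair R M N L, x.cls = e := by
  constructor
  · rintro ⟨f, g, w, h, rfl⟩
    exact ⟨⟨(f.hom, g.hom), h.moduleCat_injective_f, h.moduleCat_surjective_g,
      (ShortComplex.ShortExact.moduleCat_exact_iff_function_exact _).1 h.exact⟩, rfl⟩
  · rintro ⟨x, rfl⟩
    exact ⟨_, _, _, x.shortExact, rfl⟩

theorem ExactPair.cls_eq_of (x y : ExactPair R M N L) (φ : L →ₗ[R] L)
    (h1 : ∀ n, φ (x.1.1 n) = y.1.1 n) (h2 : ∀ l, y.1.2 (φ l) = x.1.2 l) : x.cls = y.cls := by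
  let F : x.complex ⟶ y.complex :=
    { τ₁ := 𝟙 N
      τ₂ := ModuleCat.ofHom φ
      τ₃ := 𝟙 M
      comm₁₂ := by ext n; exact (h1 n).symm
      comm₂₃ := by ext l; exact h2 l }
  have := ShortComplex.ShortExact.extClass_naturality x.shortExact y.shortExact F
  simpa [F, ExactPair.cls] using this

theorem ExactPair.exists_of_cls_eq (x y : ExactPair R M N L) (h : x.cls = y.cls) :
    ∃ φ : L →ₗ[R] L, (∀ n, φ (x.1.1 n) = y.1.1 n) ∧ ∀ l, y.1.2 (φ l) = x.1.2 l := by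
  have hxf : x.cls.comp (Ext.mk₀ (ModuleCat.ofHom y.1.1)) (add_zero 1) = 0 := by
    rw [h]; exact y.shortExact.extClass_comp
  obtain ⟨a, ha⟩ := Ext.contravariant_sequence_exact₁ x.shortExact L
    (Ext.mk₀ (ModuleCat.ofHom y.1.1)) (add_zero 1) hxf
  obtain ⟨a, rfl⟩ := Ext.homEquiv₀.symm.surjective a
  have ha' : ModuleCat.ofHom x.1.1 ≫ a = ModuleCat.ofHom y.1.1 := by
    apply Ext.homEquiv₀.symm.injective
    simpa using ha
  have ha1 : ∀ n, a.hom (x.1.1 n) = y.1.1 n := fun n =>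
    LinearMap.congr_fun (congrArg ModuleCat.Hom.hom ha') n
  obtain ⟨ψ, hψ⟩ := lift_surj x.1.2 x.2.2.1 (y.1.2 ∘ₗ a.hom) (by
    intro l hl
    obtain ⟨n, rfl⟩ := (x.2.2.2 l).1 hl
    simp only [LinearMap.comp_apply, ha1]
    exact (y.2.2.2 _).2 ⟨n, rfl⟩)
  let F : x.complex ⟶ y.complex :=
    { τ₁ := 𝟙 N
      τ₂ := a
      τ₃ := ModuleCat.ofHom ψ
      comm₁₂ := by ext n; exact (ha1 n).symm
      comm₂₃ := by ext l; exact (hψ l).symm }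
  have hn : (Ext.mk₀ (ModuleCat.ofHom ψ)).comp y.cls (zero_add 1) = y.cls := by
    have := ShortComplex.ShortExact.extClass_naturality x.shortExact y.shortExact F
    rw [show Ext.mk₀ F.τ₁ = Ext.mk₀ (𝟙 N) from rfl, Ext.comp_mk₀_id] at this
    exact this.symm.trans h
  have hn' : (Ext.mk₀ (ModuleCat.ofHom ψ - 𝟙 M)).comp y.cls (zero_add 1) = 0 := by
    rw [sub_eq_add_neg, Ext.mk₀_add, Ext.add_comp, hn, Ext.mk₀_neg, Ext.neg_comp, Ext.mk₀_id_comp,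
      add_neg_cancel]
  obtain ⟨θ, hθ⟩ := Ext.covariant_sequence_exact₃ M y.shortExact _ (zero_add 1) hn'
  obtain ⟨θ, rfl⟩ := Ext.homEquiv₀.symm.surjective θ
  have hθ' : θ ≫ ModuleCat.ofHom y.1.2 = ModuleCat.ofHom ψ - 𝟙 M := by
    apply Ext.homEquiv₀.symm.injective
    simpa using hθ
  have hθ1 : ∀ m, y.1.2 (θ.hom m) = ψ m - m := fun m =>
    LinearMap.congr_fun (congrArg ModuleCat.Hom.hom hθ') m
  refine ⟨a.hom - θ.hom ∘ₗ x.1.2, fun n => ?_, fun l => ?_⟩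
  · have : x.1.2 (x.1.1 n) = 0 := (x.2.2.2 _).2 ⟨n, rfl⟩
    simp [this, ha1]
  · have := hψ l
    simp only [LinearMap.comp_apply] at this
    simp [hθ1, ← this]

theorem ExactPair.bijective_of (x y : ExactPair R M N L) (φ : L →ₗ[R] L)
    (h1 : ∀ n, φ (x.1.1 n) = y.1.1 n) (h2 : ∀ l, y.1.2 (φ l) = x.1.2 l) :
    Function.Bijective φ := by
  constructor
  · rw [injective_iff_map_eq_zero]
    intro l hl
    have : x.1.2 l = 0 := by rw [← h2, hl, map_zero]
    obtain ⟨n, rfl⟩ := (x.2.2.2 l).1 this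
    rw [h1, map_eq_zero_iff _ y.2.1] at hl
    rw [hl, map_zero]
  · intro l
    obtain ⟨l', hl'⟩ := x.2.2.1 (y.1.2 l)
    have : y.1.2 (l - φ l') = 0 := by rw [map_sub, h2, hl', sub_self]
    obtain ⟨n, hn⟩ := (y.2.2.2 _).1 this
    exact ⟨x.1.1 n + l', by rw [map_add, h1, hn]; abel⟩

/-- The Riedtmann–Peng formula. -/
theorem riedtmann [Finite M] [Finite N] [Finite L] :
    Nat.card (extMiddle M N L) * Nat.card (L ≃ₗ[R] L) =
      Nat.card (ExactPair R M N L) * Nat.card (M ⟶ N) := by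
  classical
  rw [Nat.card_congr (ModuleCat.homEquiv (M := M) (N := N)), ← Nat.card_prod, ← Nat.card_prod]
  symm
  choose s hs using fun e : extMiddle M N L => (mem_extMiddle_iff e.1).1 e.2
  let π : ExactPair R M N L → extMiddle M N L := fun x => ⟨x.cls, (mem_extMiddle_iff _).2 ⟨x, rfl⟩⟩
  choose φ hφ1 hφ2 using fun x : ExactPair R M N L =>
    ExactPair.exists_of_cls_eq (s (π x)) x (hs (π x))
  let Φ : ExactPair R M N L → (M →ₗ[R] N) → (L →ₗ[R] L) :=
    fun x h => φ x + x.1.1 ∘ₗ h ∘ₗ (s (π x)).1.2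
  have hΦ1 : ∀ x h n, Φ x h ((s (π x)).1.1 n) = x.1.1 n := by
    intro x h n
    have : (s (π x)).1.2 ((s (π x)).1.1 n) = 0 := ((s (π x)).2.2.2 _).2 ⟨n, rfl⟩
    simp [Φ, this, hφ1]
  have hΦ2 : ∀ x h l, x.1.2 (Φ x h l) = (s (π x)).1.2 l := by
    intro x h l
    have : ∀ n, x.1.2 (x.1.1 n) = 0 := fun n => (x.2.2.2 _).2 ⟨n, rfl⟩
    simp [Φ, this, hφ2]
  refine Nat.card_congr (Equiv.ofBijective (fun xh : ExactPair R M N L × (M →ₗ[R] N) =>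
    (π xh.1, LinearEquiv.ofBijective (Φ xh.1 xh.2)
      (ExactPair.bijective_of _ _ _ (hΦ1 xh.1 xh.2) (hΦ2 xh.1 xh.2)))) ⟨?_, ?_⟩)
  · rintro ⟨x, h⟩ ⟨x', h'⟩ hh
    simp only [Prod.mk.injEq] at hh
    obtain ⟨hπ, hE⟩ := hh
    have hE' : ∀ l, Φ x h l = Φ x' h' l := fun l => LinearEquiv.congr_fun hE l
    have k1 : x.1.1 = x'.1.1 := by
      ext n
      rw [← hΦ1 x h, ← hΦ1 x' h', hE', hπ]
    have k2 : x.1.2 = x'.1.2 := by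
      ext l
      obtain ⟨l, rfl⟩ := (ExactPair.bijective_of _ _ _ (hΦ1 x h) (hΦ2 x h)).2 l
      rw [hΦ2, hE', hΦ2, hπ]
    obtain rfl : x = x' := Subtype.ext (Prod.ext k1 k2)
    congr 1
    ext m
    obtain ⟨l, rfl⟩ := (s (π x)).2.2.1 m
    apply x.2.1
    have := hE' l
    simpa [Φ] using this
  · rintro ⟨e, ψ⟩
    let x : ExactPair R M N L := ⟨(ψ.toLinearMap ∘ₗ (s e).1.1, (s e).1.2 ∘ₗ ψ.symm.toLinearMap),
      ψ.injective.comp (s e).2.1, (s e).2.2.1.comp ψ.symm.surjective, by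
        intro l
        refine ((s e).2.2.2 (ψ.symm l)).trans (exists_congr fun n => ?_)
        exact ψ.eq_symm_apply⟩
    have hx1 : ∀ n, x.1.1 n = ψ ((s e).1.1 n) := fun n => rfl
    have hx2 : ∀ l, x.1.2 (ψ l) = (s e).1.2 l := fun l => by simp [x]
    have hπ : π x = e := by
      apply Subtype.ext
      exact (ExactPair.cls_eq_of (s e) x ψ.toLinearMap (fun n => rfl) hx2).symm.trans (hs e)
    obtain ⟨c, hc⟩ := lift_surj (s e).1.2 (s e).2.2.1 (ψ.toLinearMap - φ x) (by
      intro l hl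
      obtain ⟨n, rfl⟩ := ((s e).2.2.2 l).1 hl
      have := hφ1 x n
      rw [hπ] at this
      simp [this, hx1])
    obtain ⟨h, hh⟩ := lift_inj x.1.1 x.2.1 c (by
      intro m
      obtain ⟨l, rfl⟩ := (s e).2.2.1 m
      apply (x.2.2.2 _).1
      have := hφ2 x l
      rw [hπ] at this
      simp [hc, this, hx2])
    refine ⟨(x, h), Prod.ext hπ ?_⟩
    ext l
    show φ x l + x.1.1 (h ((s (π x)).1.2 l)) = ψ l
    rw [hπ, hh, hc]
    simp

end Riedtmann

section DualNumbers

open Abelian DualNumber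

variable {k : Type u} [Field k]

/-- A linear functional over `k` on a `k[ε]`-module is the `ε`-coefficient of a unique `k[ε]`-linear
map to `k[ε]`. -/
theorem exists_dual (X : Type u) [AddCommGroup X] [Module k[ε] X] [Module k X]
    [IsScalarTower k k[ε] X] (l : X →ₗ[k] k) :
    ∃ φ : X →ₗ[k[ε]] k[ε], ∀ x, TrivSqZeroExt.snd (φ x) = l x := by
  have key : ∀ (r : k[ε]) (x : X), r • x = TrivSqZeroExt.fst r • x +
      TrivSqZeroExt.snd r • ((ε : k[ε]) • x) := by
    intro r x
    rw [← algebraMap_smul k[ε] (TrivSqZeroExt.fst r) x,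
      ← algebraMap_smul k[ε] (TrivSqZeroExt.snd r), smul_smul, ← add_smul]
    congr 1
    ext <;> simp [TrivSqZeroExt.algebraMap_eq_inl]
  have keps : ∀ x : X, (ε : k[ε]) • (ε : k[ε]) • x = 0 := by
    intro x; rw [smul_smul, DualNumber.eps_mul_eps, zero_smul]
  refine ⟨{ toFun := fun x => TrivSqZeroExt.inl (l ((ε : k[ε]) • x)) + TrivSqZeroExt.inr (l x)
            map_add' := fun x y => ?_
            map_smul' := fun r x => ?_ }, fun x => ?_⟩
  · ext <;> simp
  · have h1 : (ε : k[ε]) • r • x = TrivSqZeroExt.fst r • (ε : k[ε]) • x := by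
      rw [smul_comm, key r, keps, smul_zero, add_zero]
    rw [h1, key r x]
    ext <;> simp [mul_comm]
  · simp

theorem dual_ext (X : Type u) [AddCommGroup X] [Module k[ε] X]
    (φ ψ : X →ₗ[k[ε]] k[ε]) (h : ∀ x, TrivSqZeroExt.snd (φ x) = TrivSqZeroExt.snd (ψ x)) :
    φ = ψ := by
  ext x
  · have := h ((ε : k[ε]) • x)
    simpa using this
  · exact h x

/-- The number of `k[ε]`-linear maps `X → k[ε]` is the number of elements of `X`. -/
theorem card_dual [Finite k] (X : Type u) [AddCommGroup X] [Module k[ε] X] [Finite X] :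
    Nat.card (X →ₗ[k[ε]] k[ε]) = Nat.card X := by
  let : Module k X := Module.compHom X (algebraMap k k[ε])
  have : IsScalarTower k k[ε] X := IsScalarTower.of_algebraMap_smul fun _ _ => rfl
  have e : Nat.card (X →ₗ[k[ε]] k[ε]) = Nat.card (X →ₗ[k] k) := by
    refine Nat.card_congr (Equiv.ofBijective
      (fun φ => (TrivSqZeroExt.sndHom k k) ∘ₗ (φ.restrictScalars k)) ⟨?_, ?_⟩)
    · intro φ ψ h
      exact dual_ext X φ ψ (fun x => LinearMap.congr_fun h x)
    · intro l
      obtain ⟨φ, hφ⟩ := exists_dual X l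
      exact ⟨φ, by ext x; exact hφ x⟩
  rw [e]
  have : Module.Finite k X := Module.Finite.of_finite
  rw [Module.natCard_eq_pow_finrank (K := k), Module.natCard_eq_pow_finrank (K := k) (V := X),
    Module.finrank_linearMap, Module.finrank_self, mul_one]

/-- Free `k[ε]`-modules of finite rank are injective. -/
theorem injective_free (ι : Type) : Module.Injective k[ε] (ι → k[ε]) := by
  constructor
  intro X Y _ _ _ _ f hf g
  let : Module k X := Module.compHom X (algebraMap k k[ε])
  have : IsScalarTower k k[ε] X := IsScalarTower.of_algebraMap_smul fun _ _ => rfl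
  let : Module k Y := Module.compHom Y (algebraMap k k[ε])
  have : IsScalarTower k k[ε] Y := IsScalarTower.of_algebraMap_smul fun _ _ => rfl
  obtain ⟨r, hr⟩ := (f.restrictScalars k).exists_leftInverse_of_injective
    (LinearMap.ker_eq_bot.2 hf)
  have hr' : ∀ x, r (f x) = x := fun x => LinearMap.congr_fun hr x
  choose h hh using fun i => exists_dual Y
    ((TrivSqZeroExt.sndHom k k) ∘ₗ ((LinearMap.proj i ∘ₗ g).restrictScalars k) ∘ₗ r)
  refine ⟨LinearMap.pi h, fun x => ?_⟩
  funext i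
  have : h i ∘ₗ f = LinearMap.proj i ∘ₗ g := by
    apply dual_ext
    intro x
    simp [hh, hr']
  exact LinearMap.congr_fun this x

/-- A finitely generated module of projective dimension at most one over `k[ε]` is free. -/
theorem exists_equiv_free [Finite k] (K : ModuleCat.{u} k[ε]) [Module.Finite k[ε] K]
    [HasProjectiveDimensionLE K 1] : ∃ n : ℕ, Nonempty (K ≃ₗ[k[ε]] (Fin n → k[ε])) := by
  obtain ⟨n, p, hp⟩ := Module.Finite.exists_fin' k[ε] K
  obtain ⟨m, p', hp'⟩ := Module.Finite.exists_fin' k[ε] (LinearMap.ker p)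
  have hS := LinearMap.shortExact_shortComplexKer hp
  have hS' := LinearMap.shortExact_shortComplexKer hp'
  have : Injective (p'.shortComplexKer.X₂) :=
    have := injective_free (k := k) (Fin m)
    Module.injective_object_of_injective_module (R := k[ε]) (M := Fin m → k[ε])
  have h1 : hS.extClass = 0 := by
    obtain ⟨y, hy⟩ := Ext.covariant_sequence_exact₃ K hS' hS.extClass (n₁ := 2) rfl
      (Ext.eq_zero_of_hasProjectiveDimensionLT _ 2 le_rfl)
    rw [← hy, Ext.eq_zero_of_injective y, Ext.zero_comp]
  obtain ⟨s, hs⟩ := Ext.covariant_sequence_exact₃ K hS (Ext.mk₀ (𝟙 K)) (zero_add 1)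
    (by rw [h1, Ext.comp_zero])
  obtain ⟨s, rfl⟩ := Ext.homEquiv₀.symm.surjective s
  have hs' : s ≫ p.shortComplexKer.g = 𝟙 K := by
    apply Ext.homEquiv₀.symm.injective
    simpa using hs
  have hproj : Module.Projective k[ε] K :=
    Module.Projective.of_split s.hom p (congrArg ModuleCat.Hom.hom hs')
  have : Module.Free k[ε] K := Module.free_of_flat_of_isLocalRing
  exact ⟨_, ⟨(Module.finBasis k[ε] K).equivFun⟩⟩

theorem finite_of_fg [Finite k] (X : Type u) [AddCommGroup X] [Module k[ε] X]
    [Module.Finite k[ε] X] : Finite X :=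
  have : Finite k[ε] := inferInstanceAs (Finite (k × k))
  Module.finite_of_finite k[ε]

/-- The key symmetry: for `K` of projective dimension at most one the structure constants for
`K, M` and `M, K` agree. -/
theorem exactPair_swap [Finite k] (K M L : Type u) [AddCommGroup K] [Module k[ε] K]
    [AddCommGroup M] [Module k[ε] M] [AddCommGroup L] [Module k[ε] L] {n : ℕ}
    (e : K ≃ₗ[k[ε]] (Fin n → k[ε])) :
    Nonempty (ExactPair k[ε] K M L) ↔ Nonempty (ExactPair k[ε] M K L) := by
  constructor
  · rintro ⟨⟨f, g⟩, hf, hg, hfg⟩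
    dsimp only at *
    have : Module.Projective k[ε] K := Module.Projective.of_equiv e.symm
    obtain ⟨s, hs⟩ := Module.projective_lifting_property g LinearMap.id hg
    have hs' : ∀ x, g (s x) = x := fun x => LinearMap.congr_fun hs x
    obtain ⟨r, hr⟩ := lift_inj f hf (LinearMap.id - s ∘ₗ g) (by
      intro l
      apply (hfg _).1
      simp [hs'])
    have hr' : ∀ l, f (r l) = l - s (g l) := fun l => by simpa using hr l
    refine ⟨⟨(s, r), fun x y h => by rw [← hs' x, ← hs' y]; exact congrArg g h, fun m => ⟨f m, ?_⟩,
      fun l => ?_⟩⟩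
    · apply hf
      dsimp only
      rw [hr', (hfg (f m)).2 ⟨m, rfl⟩, map_zero, sub_zero]
    · dsimp only
      rw [← map_eq_zero_iff f hf, hr']
      constructor
      · intro h; exact ⟨g l, (sub_eq_zero.1 h).symm⟩
      · rintro ⟨x, rfl⟩; rw [hs', sub_self]
  · rintro ⟨⟨f, g⟩, hf, hg, hfg⟩
    dsimp only at *
    obtain ⟨r, hr⟩ := (injective_free (k := k) (Fin n)).out (f ∘ₗ e.symm.toLinearMap)
      (hf.comp e.symm.injective) LinearMap.id
    have hr' : ∀ x, e.symm (r (f x)) = x := fun x => by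
      have := hr (e x); simp at this; simp [this]
    obtain ⟨s, hs⟩ := lift_surj g hg (LinearMap.id - f ∘ₗ e.symm.toLinearMap ∘ₗ r) (by
      intro l hl
      obtain ⟨x, rfl⟩ := (hfg l).1 hl
      simp [hr'])
    have hs' : ∀ l, s (g l) = l - f (e.symm (r l)) := fun l => by simpa using hs l
    have hgf : ∀ x, g (f x) = 0 := fun x => (hfg _).2 ⟨x, rfl⟩
    have hgs : ∀ m, g (s m) = m := by
      intro m
      obtain ⟨l, rfl⟩ := hg m
      rw [hs', map_sub, hgf, sub_zero]
    refine ⟨⟨(s, e.symm.toLinearMap ∘ₗ r), fun x y h => by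
      rw [← hgs x, ← hgs y]; exact congrArg g h, fun x => ⟨f x, hr' x⟩, fun l => ?_⟩⟩
    dsimp only
    constructor
    · intro h
      refine ⟨g l, ?_⟩
      rw [LinearMap.comp_apply, LinearEquiv.coe_coe] at h
      rw [hs', h, map_zero, sub_zero]
    · rintro ⟨m, rfl⟩
      obtain ⟨l, rfl⟩ := hg m
      rw [LinearMap.comp_apply, LinearEquiv.coe_coe, hs', map_sub, map_sub, hr', sub_self]

theorem card_hom_swap [Finite k] (K M : Type u) [AddCommGroup K] [Module k[ε] K]
    [AddCommGroup M] [Module k[ε] M] [Finite M] {n : ℕ} (e : K ≃ₗ[k[ε]] (Fin n → k[ε])) :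
    Nat.card (K →ₗ[k[ε]] M) = Nat.card (M →ₗ[k[ε]] K) := by
  have h1 : Nat.card (K →ₗ[k[ε]] M) = Nat.card M ^ n := by
    rw [Nat.card_congr (((Pi.basisFun k[ε] (Fin n)).map e.symm).constr ℕ (M' := M)).symm.toEquiv,
      Nat.card_fun, Nat.card_fin]
  have h2 : Nat.card (M →ₗ[k[ε]] K) = Nat.card M ^ n := by
    rw [Nat.card_congr (e.congrRight (M := M)).toEquiv,
      ← Nat.card_congr (LinearEquiv.linearMapPi (R := k[ε]) (M₂ := M)
        (φ := fun _ : Fin n => k[ε]) k[ε]).toEquiv, Nat.card_fun, Nat.card_fin, card_dual]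
  rw [h1, h2]

theorem card_extMiddle_swap [Finite k] (K M L : ModuleCat.{u} k[ε]) {n : ℕ}
    (e : K ≃ₗ[k[ε]] (Fin n → k[ε])) :
    Nat.card (extMiddle K M L) = Nat.card (extMiddle M K L) := by
  have hp : Projective K := by
    have : Module.Projective k[ε] K := Module.Projective.of_equiv e.symm
    exact (IsProjective.iff_projective (R := k[ε]) (P := K)).1 this
  have hi : Injective K := by
    have : Injective (ModuleCat.of k[ε] (Fin n → k[ε])) :=
      have := injective_free (k := k) (Fin n)
      Module.injective_object_of_injective_module (R := k[ε]) (M := Fin n → k[ε])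
    exact Injective.of_iso e.toModuleIso.symm this
  have hs1 : Subsingleton (Ext.{u} K M 1) := Ext.subsingleton_of_projective _ _ _
  have hs2 : Subsingleton (Ext.{u} M K 1) := Ext.subsingleton_of_injective _ _ _
  have key : Nonempty (extMiddle K M L) ↔ Nonempty (extMiddle M K L) := by
    refine Iff.trans ?_ ((exactPair_swap K M L e).trans ?_)
    · constructor
      · rintro ⟨y⟩
        obtain ⟨x, -⟩ := (mem_extMiddle_iff _).1 y.2
        exact ⟨x⟩
      · rintro ⟨x⟩
        exact ⟨⟨x.cls, (mem_extMiddle_iff _).2 ⟨x, rfl⟩⟩⟩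
    · constructor
      · rintro ⟨x⟩
        exact ⟨⟨ExactPair.cls (M := M) (N := K) (L := L) x, (mem_extMiddle_iff _).2 ⟨x, rfl⟩⟩⟩
      · rintro ⟨y⟩
        obtain ⟨x, -⟩ := (mem_extMiddle_iff _).1 y.2
        exact ⟨x⟩
  by_cases h : Nonempty (extMiddle K M L)
  · have h' := key.1 h
    have := (nonempty_unique (extMiddle K M L))
    obtain ⟨_⟩ := nonempty_unique (extMiddle K M L)
    obtain ⟨_⟩ := nonempty_unique (extMiddle M K L)
    rw [Nat.card_unique, Nat.card_unique]
  · have h' := mt key.2 h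
    rw [not_nonempty_iff] at h h'
    rw [Nat.card_of_isEmpty, Nat.card_of_isEmpty]

end DualNumbers

section Algebra

open Abelian DualNumber

/-- Isomorphism classes of finite-dimensional modules over `Λ = k[x]/(x²)`, where `Λ` is the ring
`k[ε]` of dual numbers. All these modules are nilpotent because `ε² = 0`. -/
abbrev IsoClass (k : Type u) [Field k] : Type (u + 1) :=
  Quotient (isIsomorphicSetoid (FGModuleCat.{u} k[ε]))

/-- The field `ℚ(v)` with `v = √q`, where `q` is the number of elements of `k`. -/
def QV (k : Type u) : Type :=
  IntermediateField.adjoin ℚ {Real.sqrt (Nat.card k : ℝ)}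

noncomputable instance (k : Type u) : Field (QV k) :=
  inferInstanceAs (Field (IntermediateField.adjoin ℚ {Real.sqrt (Nat.card k : ℝ)}))

instance (k : Type u) : CharZero (QV k) :=
  inferInstanceAs (CharZero (IntermediateField.adjoin ℚ {Real.sqrt (Nat.card k : ℝ)}))

/-- `v = √q`. -/
noncomputable def v (k : Type u) : QV k :=
  IntermediateField.AdjoinSimple.gen ℚ (Real.sqrt (Nat.card k : ℝ))

theorem v_sq (k : Type u) : v k ^ 2 = (Nat.card k : QV k) := by
  have h : (IntermediateField.AdjoinSimple.gen ℚ (Real.sqrt (Nat.card k : ℝ))) ^ 2 =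
      (Nat.card k : IntermediateField.adjoin ℚ {Real.sqrt (Nat.card k : ℝ)}) := by
    apply Subtype.ext
    simp
  exact h

variable {k : Type u} [Field k]

/-- The dimension of the `k`-vector space `res M`, where `res` is the restriction along `k → Λ`. -/
noncomputable def resDim (M : FGModuleCat.{u} k[ε]) : ℕ :=
  Module.finrank k ((ModuleCat.restrictScalars (algebraMap k k[ε])).obj M.obj)

/-- The Euler form `⟨res M, res N⟩_Q`. The quiver `Q` has one vertex and no arrows, so `kQ = k` and
`⟨V, W⟩_Q = dim Hom_k(V, W) - dim Ext¹_k(V, W) = dim V * dim W`. -/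
noncomputable def eulerForm (M N : FGModuleCat.{u} k[ε]) : ℤ := resDim M * resDim N

/-- The coefficient of `[L]` in the twisted Hall product `[M] * [N]`, namely
`v ^ ⟨res M, res N⟩_Q * |Ext¹(M, N)_L| / |Hom(M, N)|`. -/
noncomputable def structConst (M N L : FGModuleCat.{u} k[ε]) : QV k :=
  v k ^ eulerForm M N * ((Nat.card (extMiddle M.obj N.obj L.obj) : QV k) /
    (Nat.card (M.obj ⟶ N.obj) : QV k))

theorem mk_eq_mk_iff (M N : FGModuleCat.{u} k[ε]) :
    (⟦M⟧ : IsoClass k) = ⟦N⟧ ↔ Nonempty (M.obj ≃ₗ[k[ε]] N.obj) := by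
  rw [Quotient.eq]
  constructor
  · rintro ⟨e⟩; exact ⟨FGModuleCat.isoToLinearEquiv e⟩
  · rintro ⟨e⟩
    exact ⟨(ModuleCat.isFG k[ε]).isoMk e.toModuleIso⟩

variable [Finite k]

instance (M : FGModuleCat.{u} k[ε]) : Finite M.obj :=
  have : Module.Finite k[ε] M.obj := M.property
  finite_of_fg (k := k) M.obj

theorem v_ne_zero : v k ≠ 0 := by
  intro h
  have := v_sq k
  rw [h] at this
  have h2 : (Nat.card k : QV k) ≠ 0 := Nat.cast_ne_zero.2 Nat.card_pos.ne'
  exact h2 (by rw [← this]; simp)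

theorem card_eq_pow_resDim (M : FGModuleCat.{u} k[ε]) :
    Nat.card M.obj = Nat.card k ^ resDim M := by
  have : Finite ((ModuleCat.restrictScalars (algebraMap k k[ε])).obj M.obj) :=
    inferInstanceAs (Finite M.obj)
  have : Module.Finite k ((ModuleCat.restrictScalars (algebraMap k k[ε])).obj M.obj) :=
    Module.Finite.of_finite
  exact Module.natCard_eq_pow_finrank (K := k)
    (V := (ModuleCat.restrictScalars (algebraMap k k[ε])).obj M.obj)

theorem resDim_eq_of_card {M N : FGModuleCat.{u} k[ε]} (h : Nat.card M.obj = Nat.card N.obj) :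
    resDim M = resDim N := by
  rw [card_eq_pow_resDim, card_eq_pow_resDim] at h
  exact Nat.pow_right_injective Finite.one_lt_card h

theorem resDim_add {M N L : FGModuleCat.{u} k[ε]} (x : ExactPair k[ε] M.obj N.obj L.obj) :
    resDim L = resDim M + resDim N := by
  have h := card_of_exactPair x
  rw [card_eq_pow_resDim, card_eq_pow_resDim, card_eq_pow_resDim, ← pow_add] at h
  exact Nat.pow_right_injective Finite.one_lt_card h

theorem card_aut_ne_zero (L : FGModuleCat.{u} k[ε]) :
    (Nat.card (L.obj ≃ₗ[k[ε]] L.obj) : QV k) ≠ 0 :=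
  have : Nonempty (L.obj ≃ₗ[k[ε]] L.obj) := ⟨LinearEquiv.refl _ _⟩
  Nat.cast_ne_zero.2 Nat.card_pos.ne'

instance (M N : ModuleCat.{u} k[ε]) [Finite M] [Finite N] : Finite (M ⟶ N) :=
  Finite.of_equiv _ (ModuleCat.homEquiv (M := M) (N := N)).symm

theorem structConst_eq (M N L : FGModuleCat.{u} k[ε]) :
    structConst M N L = v k ^ eulerForm M N * ((Nat.card (ExactPair k[ε] M.obj N.obj L.obj) : QV k) /
      (Nat.card (L.obj ≃ₗ[k[ε]] L.obj) : QV k)) := by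
  have h := congrArg (Nat.cast (R := QV k)) (riedtmann (M := M.obj) (N := N.obj) (L := L.obj))
  push_cast at h
  have h1 : (Nat.card (M.obj ⟶ N.obj) : QV k) ≠ 0 :=
    have : Nonempty (M.obj ⟶ N.obj) := ⟨0⟩
    Nat.cast_ne_zero.2 Nat.card_pos.ne'
  rw [structConst, div_eq_div_iff h1 (card_aut_ne_zero L) |>.2 h]

theorem structConst_congr {M N L M' N' L' : FGModuleCat.{u} k[ε]}
    (eM : (⟦M⟧ : IsoClass k) = ⟦M'⟧) (eN : (⟦N⟧ : IsoClass k) = ⟦N'⟧)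
    (eL : (⟦L⟧ : IsoClass k) = ⟦L'⟧) : structConst M N L = structConst M' N' L' := by
  obtain ⟨eM⟩ := (mk_eq_mk_iff _ _).1 eM
  obtain ⟨eN⟩ := (mk_eq_mk_iff _ _).1 eN
  obtain ⟨eL⟩ := (mk_eq_mk_iff _ _).1 eL
  have h1 : eulerForm M N = eulerForm M' N' := by
    rw [eulerForm, eulerForm, resDim_eq_of_card (Nat.card_congr eM.toEquiv),
      resDim_eq_of_card (Nat.card_congr eN.toEquiv)]
  have h2 : Nat.card (L.obj ≃ₗ[k[ε]] L.obj) = Nat.card (L'.obj ≃ₗ[k[ε]] L'.obj) :=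
    Nat.card_congr ⟨fun f => (eL.symm.trans f).trans eL, fun f => (eL.trans f).trans eL.symm,
      fun f => by ext; simp, fun f => by ext; simp⟩
  have h3 := card_exactPair_congr eM eN eL
  simp only [structConst_eq, h1, h2, h3]

/-- The structure constants on isomorphism classes. -/
noncomputable def isoConst (a b c : IsoClass k) : QV k := structConst a.out b.out c.out

theorem isoConst_mk (M N L : FGModuleCat.{u} k[ε]) :
    isoConst (⟦M⟧ : IsoClass k) ⟦N⟧ ⟦L⟧ = structConst M N L :=
  structConst_congr (Quotient.out_eq _) (Quotient.out_eq _) (Quotient.out_eq _)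

theorem nonempty_of_isoConst_ne_zero {a b c : IsoClass k} (h : isoConst a b c ≠ 0) :
    Nonempty (ExactPair k[ε] a.out.obj b.out.obj c.out.obj) := by
  by_contra hn
  rw [not_nonempty_iff] at hn
  exact h (by rw [isoConst, structConst_eq, Nat.card_of_isEmpty]; simp)

theorem finite_support (a b : IsoClass k) : (Function.support (isoConst a b)).Finite := by
  have hΛ : Finite k[ε] := inferInstanceAs (Finite (k × k))
  set m := Nat.card a.out.obj * Nat.card b.out.obj with hm
  refine Set.Finite.subset (Set.finite_range (fun U : Submodule k[ε] (Fin m → k[ε]) =>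
    (⟦FGModuleCat.of k[ε] ((Fin m → k[ε]) ⧸ U)⟧ : IsoClass k))) ?_
  intro c hc
  obtain ⟨x⟩ := nonempty_of_isoConst_ne_zero hc
  have hcard := card_of_exactPair x
  let e : c.out.obj ≃ Fin m := (Finite.equivFin c.out.obj).trans (finCongr hcard)
  let p : (Fin m → k[ε]) →ₗ[k[ε]] c.out.obj := Fintype.linearCombination k[ε] e.symm
  have hp : Function.Surjective p := by
    intro l
    refine ⟨Pi.single (e l) 1, ?_⟩
    simp [p]
  refine ⟨LinearMap.ker p, ?_⟩
  dsimp only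
  exact ((mk_eq_mk_iff _ _).2 ⟨p.quotKerEquivOfSurjective hp⟩).trans (Quotient.out_eq c)

/-- The twisted Hall product `[a] * [b]` of two isomorphism classes. -/
noncomputable def basisMul (a b : IsoClass k) : IsoClass k →₀ QV k :=
  Finsupp.ofSupportFinite (isoConst a b) (finite_support a b)

theorem basisMul_apply (a b c : IsoClass k) : basisMul a b c = isoConst a b c := rfl

open Classical in
/-- Counting along the isomorphism classes of a finite family of modules. -/
theorem card_sigma_equiv {T : Type u} [Finite T] (Q : T → FGModuleCat.{u} k[ε])
    (l : IsoClass k) :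
    (Nat.card (Σ t : T, (Q t).obj ≃ₗ[k[ε]] l.out.obj) : QV k) =
      (Nat.card {t : T // (⟦Q t⟧ : IsoClass k) = l} : QV k) *
        Nat.card (l.out.obj ≃ₗ[k[ε]] l.out.obj) := by
  have := Fintype.ofFinite T
  have h : ∀ t, Nat.card ((Q t).obj ≃ₗ[k[ε]] l.out.obj) =
      if (⟦Q t⟧ : IsoClass k) = l then Nat.card (l.out.obj ≃ₗ[k[ε]] l.out.obj) else 0 := by
    intro t
    rw [card_linearEquiv]
    refine if_congr ?_ rfl rfl
    rw [← mk_eq_mk_iff, Quotient.out_eq]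
  have h4 : Nat.card {t : T // (⟦Q t⟧ : IsoClass k) = l} =
      (Finset.univ.filter fun t => (⟦Q t⟧ : IsoClass k) = l).card := by
    rw [Nat.card_eq_fintype_card, Fintype.card_subtype]
  rw [Nat.card_sigma, Finset.sum_congr rfl (fun t _ => h t), ← Finset.sum_filter, Finset.sum_const,
    smul_eq_mul, Nat.cast_mul, h4]

theorem sum_card_fiber {T : Type u} [Finite T] (c : T → IsoClass k) (s : Finset (IsoClass k))
    (hs : ∀ t, c t ∈ s) :
    ∑ l ∈ s, (Nat.card {t : T // c t = l} : QV k) = Nat.card T := by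
  classical
  have := Fintype.ofFinite T
  rw [Nat.card_eq_fintype_card, ← Finset.card_univ,
    Finset.card_eq_sum_card_fiberwise (f := c) (t := s) (fun t _ => hs t), Nat.cast_sum]
  refine Finset.sum_congr rfl fun l _ => ?_
  rw [Nat.card_eq_fintype_card, Fintype.card_subtype]

theorem assoc_left (a b c d : IsoClass k) (s : Finset (IsoClass k))
    (hs : ∀ l, isoConst a b l ≠ 0 → l ∈ s) :
    ∑ l ∈ s, isoConst a b l * isoConst l c d =
      v k ^ (eulerForm a.out b.out + eulerForm a.out c.out + eulerForm b.out c.out) *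
        (Nat.card (Flag k[ε] a.out.obj b.out.obj c.out.obj d.out.obj) /
          Nat.card (d.out.obj ≃ₗ[k[ε]] d.out.obj)) := by
  set T := Flag k[ε] a.out.obj b.out.obj c.out.obj d.out.obj with hT
  let Q : T → FGModuleCat.{u} k[ε] := fun t =>
    FGModuleCat.of k[ε] (d.out.obj ⧸ LinearMap.range t.1.1)
  have hd := card_aut_ne_zero d.out
  have term : ∀ l, isoConst a b l * isoConst l c d =
      v k ^ (eulerForm a.out b.out + eulerForm a.out c.out + eulerForm b.out c.out) *
        ((Nat.card {t : T // (⟦Q t⟧ : IsoClass k) = l} : QV k) /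
          Nat.card (d.out.obj ≃ₗ[k[ε]] d.out.obj)) := by
    intro l
    have hl := card_aut_ne_zero l.out
    have h1 := card_left (R := k[ε]) (A := a.out.obj) (B := b.out.obj) (C := c.out.obj)
      (D := d.out.obj) (L := l.out.obj)
    have h2 := card_sigma_equiv Q l
    have h3 : (Nat.card (ExactPair k[ε] a.out.obj b.out.obj l.out.obj) : QV k) *
        Nat.card (ExactPair k[ε] l.out.obj c.out.obj d.out.obj) =
        (Nat.card {t : T // (⟦Q t⟧ : IsoClass k) = l} : QV k) *
        Nat.card (l.out.obj ≃ₗ[k[ε]] l.out.obj) := by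
      rw [← h2, ← Nat.cast_mul, ← Nat.card_prod, h1]
    rw [isoConst, isoConst, structConst_eq, structConst_eq]
    by_cases hne : Nonempty (ExactPair k[ε] a.out.obj b.out.obj l.out.obj)
    · obtain ⟨x⟩ := hne
      have hdim := resDim_add x
      have he : v k ^ (eulerForm a.out b.out + eulerForm a.out c.out + eulerForm b.out c.out) =
          v k ^ eulerForm a.out b.out * v k ^ eulerForm l.out c.out := by
        rw [← zpow_add₀ v_ne_zero, eulerForm, eulerForm, eulerForm, eulerForm, hdim]
        congr 1
        push_cast
        ring
      rw [he]
      field_simp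
      linear_combination (v k ^ eulerForm a.out b.out * v k ^ eulerForm l.out c.out) * h3
    · rw [not_nonempty_iff] at hne
      rw [Nat.card_of_isEmpty, Nat.cast_zero, zero_mul] at h3
      have h4 := (mul_eq_zero.1 h3.symm).resolve_right hl
      rw [h4, Nat.card_of_isEmpty]
      simp
  rw [Finset.sum_congr rfl fun l _ => term l, ← Finset.mul_sum, ← Finset.sum_div,
    sum_card_fiber (fun t => (⟦Q t⟧ : IsoClass k)) s]
  intro t
  apply hs
  have hne : (Nat.card {t' : T // (⟦Q t'⟧ : IsoClass k) = ⟦Q t⟧} : QV k) ≠ 0 :=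
    have : Nonempty {t' : T // (⟦Q t'⟧ : IsoClass k) = ⟦Q t⟧} := ⟨⟨t, rfl⟩⟩
    Nat.cast_ne_zero.2 Nat.card_pos.ne'
  intro h0
  have := term ⟦Q t⟧
  rw [h0, zero_mul] at this
  exact mul_ne_zero (zpow_ne_zero _ v_ne_zero) (div_ne_zero hne hd) this.symm

theorem assoc_right (a b c d : IsoClass k) (s : Finset (IsoClass k))
    (hs : ∀ l, isoConst b c l ≠ 0 → l ∈ s) :
    ∑ l ∈ s, isoConst b c l * isoConst a l d =
      v k ^ (eulerForm a.out b.out + eulerForm a.out c.out + eulerForm b.out c.out) *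
        (Nat.card (Flag k[ε] a.out.obj b.out.obj c.out.obj d.out.obj) /
          Nat.card (d.out.obj ≃ₗ[k[ε]] d.out.obj)) := by
  have hΛ : Finite k[ε] := inferInstanceAs (Finite (k × k))
  set T := Flag k[ε] a.out.obj b.out.obj c.out.obj d.out.obj with hT
  let Q : T → FGModuleCat.{u} k[ε] := fun t => FGModuleCat.of k[ε] (LinearMap.ker t.1.2.1)
  have hd := card_aut_ne_zero d.out
  have term : ∀ l, isoConst b c l * isoConst a l d =
      v k ^ (eulerForm a.out b.out + eulerForm a.out c.out + eulerForm b.out c.out) *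
        ((Nat.card {t : T // (⟦Q t⟧ : IsoClass k) = l} : QV k) /
          Nat.card (d.out.obj ≃ₗ[k[ε]] d.out.obj)) := by
    intro l
    have hl := card_aut_ne_zero l.out
    have h1 := card_right (R := k[ε]) (A := a.out.obj) (B := b.out.obj) (C := c.out.obj)
      (D := d.out.obj) (L := l.out.obj)
    have h2 := card_sigma_equiv Q l
    have h3 : (Nat.card (ExactPair k[ε] b.out.obj c.out.obj l.out.obj) : QV k) *
        Nat.card (ExactPair k[ε] a.out.obj l.out.obj d.out.obj) =
        (Nat.card {t : T // (⟦Q t⟧ : IsoClass k) = l} : QV k) *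
        Nat.card (l.out.obj ≃ₗ[k[ε]] l.out.obj) := by
      rw [← h2, ← Nat.cast_mul, ← Nat.card_prod, h1]
    rw [isoConst, isoConst, structConst_eq, structConst_eq]
    by_cases hne : Nonempty (ExactPair k[ε] b.out.obj c.out.obj l.out.obj)
    · obtain ⟨x⟩ := hne
      have hdim := resDim_add x
      have he : v k ^ (eulerForm a.out b.out + eulerForm a.out c.out + eulerForm b.out c.out) =
          v k ^ eulerForm b.out c.out * v k ^ eulerForm a.out l.out := by
        rw [← zpow_add₀ v_ne_zero, eulerForm, eulerForm, eulerForm, eulerForm, hdim]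
        congr 1
        push_cast
        ring
      rw [he]
      field_simp
      linear_combination (v k ^ eulerForm b.out c.out * v k ^ eulerForm a.out l.out) * h3
    · rw [not_nonempty_iff] at hne
      rw [Nat.card_of_isEmpty, Nat.cast_zero, zero_mul] at h3
      have h4 := (mul_eq_zero.1 h3.symm).resolve_right hl
      rw [h4, Nat.card_of_isEmpty]
      simp
  rw [Finset.sum_congr rfl fun l _ => term l, ← Finset.mul_sum, ← Finset.sum_div,
    sum_card_fiber (fun t => (⟦Q t⟧ : IsoClass k)) s]
  intro t
  apply hs
  have hne : (Nat.card {t' : T // (⟦Q t'⟧ : IsoClass k) = ⟦Q t⟧} : QV k) ≠ 0 :=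
    have : Nonempty {t' : T // (⟦Q t'⟧ : IsoClass k) = ⟦Q t⟧} := ⟨⟨t, rfl⟩⟩
    Nat.cast_ne_zero.2 Nat.card_pos.ne'
  intro h0
  have := term ⟦Q t⟧
  rw [h0, zero_mul] at this
  exact mul_ne_zero (zpow_ne_zero _ v_ne_zero) (div_ne_zero hne hd) this.symm

/-- The class of the zero module. -/
noncomputable def zeroClass : IsoClass k := ⟦FGModuleCat.of k[ε] PUnit.{u + 1}⟧

theorem resDim_zero (Z : FGModuleCat.{u} k[ε]) [Subsingleton Z.obj] : resDim Z = 0 := by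
  have h := card_eq_pow_resDim Z
  rw [Nat.card_of_subsingleton (0 : Z.obj)] at h
  by_contra hne
  exact (Nat.one_lt_pow hne (Finite.one_lt_card (α := k))).ne h

open Classical in
theorem isoConst_of_equiv (a b c : IsoClass k) (h0 : eulerForm a.out b.out = 0)
    (e : IsoClass k) (he : ExactPair k[ε] a.out.obj b.out.obj c.out.obj ≃
      (e.out.obj ≃ₗ[k[ε]] c.out.obj)) :
    isoConst a b c = if e = c then 1 else 0 := by
  rw [isoConst, structConst_eq, h0, zpow_zero, one_mul, Nat.card_congr he, card_linearEquiv,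
    ← mk_eq_mk_iff, Quotient.out_eq, Quotient.out_eq]
  split_ifs
  · exact div_self (card_aut_ne_zero _)
  · simp

instance : Subsingleton (zeroClass (k := k)).out.obj := by
  obtain ⟨e⟩ := (mk_eq_mk_iff _ _).1 (Quotient.out_eq (zeroClass (k := k)))
  exact (e.toEquiv.subsingleton_congr).2 inferInstance

theorem basisMul_zero_left (b : IsoClass k) : basisMul zeroClass b = Finsupp.single b 1 := by
  classical
  ext c
  rw [basisMul_apply, Finsupp.single_apply]
  apply isoConst_of_equiv
  · rw [eulerForm, resDim_zero]; simp
  · exact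
    { toFun := fun x => LinearEquiv.ofBijective x.1.1 ⟨x.2.1, fun l =>
        (x.2.2.2 l).1 (Subsingleton.elim _ _)⟩
      invFun := fun f => ⟨(f.toLinearMap, 0), f.injective, fun z => ⟨0, Subsingleton.elim _ _⟩,
        fun l => ⟨fun _ => f.surjective l, fun _ => Subsingleton.elim _ _⟩⟩
      left_inv := fun x => Subtype.ext (Prod.ext (by ext; rfl) (by ext; exact Subsingleton.elim _ _))
      right_inv := fun f => by ext; rfl }

theorem basisMul_zero_right (a : IsoClass k) : basisMul a zeroClass = Finsupp.single a 1 := by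
  classical
  ext c
  rw [basisMul_apply, Finsupp.single_apply]
  apply isoConst_of_equiv
  · rw [eulerForm, resDim_zero (zeroClass (k := k)).out]; simp
  · have hi : ∀ x : ExactPair k[ε] a.out.obj (zeroClass (k := k)).out.obj c.out.obj,
        Function.Injective x.1.2 := by
      intro x
      rw [injective_iff_map_eq_zero]
      intro l hl
      obtain ⟨z, rfl⟩ := (x.2.2.2 l).1 hl
      rw [Subsingleton.elim z 0, map_zero]
    exact
    { toFun := fun x => (LinearEquiv.ofBijective x.1.2 ⟨hi x, x.2.2.1⟩).symm
      invFun := fun f => ⟨(0, f.symm.toLinearMap), fun z z' _ => Subsingleton.elim _ _,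
        f.symm.surjective, fun l => ⟨fun h => ⟨0, by
          have : f.symm l = 0 := h
          rw [map_zero, (map_eq_zero_iff f.symm f.symm.injective).1 this]⟩, by
          rintro ⟨z, rfl⟩
          simp⟩⟩
      left_inv := fun x => Subtype.ext (Prod.ext (by
        ext z
        show (0 : _) = x.1.1 z
        rw [Subsingleton.elim z 0, map_zero]) (by ext; rfl))
      right_inv := fun f => LinearEquiv.ext fun y =>
        (LinearEquiv.symm_apply_eq _).2 (f.symm_apply_apply y).symm }

variable (k) in
/-- The twisted Hall algebra of `mod Λ` over `ℚ(v)`: the vector space on the isomorphism classes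
with the product `[M] * [N] = v ^ ⟨res M, res N⟩_Q * ∑ [L], |Ext¹(M, N)_L| / |Hom(M, N)| [L]`. -/
def HallAlgebra : Type (u + 1) := IsoClass k →₀ QV k

namespace HallAlgebra

noncomputable instance : AddCommGroup (HallAlgebra k) :=
  inferInstanceAs (AddCommGroup (IsoClass k →₀ QV k))

noncomputable instance : Module (QV k) (HallAlgebra k) :=
  inferInstanceAs (Module (QV k) (IsoClass k →₀ QV k))

/-- The basis vector of an isomorphism class. -/
noncomputable def basis (a : IsoClass k) : HallAlgebra k := Finsupp.single a 1

/-- The element `[M]` of the Hall algebra. -/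
noncomputable def cls (M : FGModuleCat.{u} k[ε]) : HallAlgebra k := basis ⟦M⟧

/-- The bilinear multiplication determined by `basisMul`. -/
noncomputable def mulLin : HallAlgebra k →ₗ[QV k] HallAlgebra k →ₗ[QV k] HallAlgebra k :=
  Finsupp.linearCombination (QV k) (M := (IsoClass k →₀ QV k) →ₗ[QV k] (IsoClass k →₀ QV k))
    fun a => Finsupp.linearCombination (QV k) fun b => basisMul a b

noncomputable instance : Mul (HallAlgebra k) := ⟨fun x y => mulLin x y⟩

noncomputable instance : One (HallAlgebra k) := ⟨basis zeroClass⟩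

theorem mul_def (x y : HallAlgebra k) : x * y = mulLin x y := rfl

theorem one_def : (1 : HallAlgebra k) = basis zeroClass := rfl

theorem basis_mul_basis (a b : IsoClass k) :
    basis a * basis b = (basisMul a b : IsoClass k →₀ QV k) := by
  rw [mul_def, mulLin, basis, basis]
  erw [Finsupp.linearCombination_single, one_smul, Finsupp.linearCombination_single, one_smul]

theorem basisMul_eq_sum (a b : IsoClass k) :
    (basisMul a b : HallAlgebra k) =
      ∑ l ∈ (basisMul a b).support, isoConst a b l • basis l := by
  conv_lhs => rw [← Finsupp.sum_single (basisMul a b)]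
  refine Finset.sum_congr rfl fun l _ => ?_
  simp only [basis]
  erw [Finsupp.smul_single]
  rw [smul_eq_mul, mul_one, basisMul_apply]

theorem induction {p : HallAlgebra k → Prop} (x : HallAlgebra k) (h0 : p 0)
    (hadd : ∀ x y, p x → p y → p (x + y)) (hb : ∀ (r : QV k) a, p (r • basis a)) : p x := by
  refine Finsupp.induction_linear (motive := p) x h0 hadd fun a r => ?_
  have : (Finsupp.single a r : IsoClass k →₀ QV k) = r • Finsupp.single a 1 := by simp
  rw [this]
  exact hb r a

theorem basis_assoc (a b c : IsoClass k) :
    basis a * basis b * basis c = basis a * (basis b * basis c) := by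
  rw [basis_mul_basis, basis_mul_basis, basisMul_eq_sum a b, basisMul_eq_sum b c, mul_def, mul_def,
    map_sum, map_sum, LinearMap.sum_apply]
  simp only [map_smul, LinearMap.smul_apply, ← mul_def, basis_mul_basis]
  refine Finsupp.ext fun d => ?_
  refine (Finsupp.finsetSum_apply _ _ _).trans (Eq.trans ?_ (Finsupp.finsetSum_apply _ _ _).symm)
  exact (assoc_left a b c d _ fun l hl => Finsupp.mem_support_iff.2 hl).trans
    (assoc_right a b c d _ fun l hl => Finsupp.mem_support_iff.2 hl).symm

protected theorem mul_assoc' (x y z : HallAlgebra k) : x * y * z = x * (y * z) := by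
  simp only [mul_def]
  refine induction (p := fun x => mulLin (mulLin x y) z = mulLin x (mulLin y z)) x (by simp)
    (fun x x' h h' => by simp [h, h']) fun r a => ?_
  refine induction (p := fun y => mulLin (mulLin (r • basis a) y) z =
    mulLin (r • basis a) (mulLin y z)) y (by simp)
    (fun x x' h h' => by simp only [map_add, LinearMap.add_apply, h, h']) fun s b => ?_
  refine induction (p := fun z => mulLin (mulLin (r • basis a) (s • basis b)) z =
    mulLin (r • basis a) (mulLin (s • basis b) z)) z (by simp)
    (fun x x' h h' => by simp only [map_add, h, h']) fun t c => ?_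
  have := basis_assoc a b c
  simp only [mul_def] at this
  simp [this]

protected theorem one_mul' (x : HallAlgebra k) : 1 * x = x := by
  rw [mul_def, one_def]
  refine induction (p := fun x => mulLin (basis zeroClass) x = x) x (by simp)
    (fun x x' h h' => by simp [h, h']) fun r a => ?_
  rw [map_smul, ← mul_def, basis_mul_basis, basisMul_zero_left]
  rfl

protected theorem mul_one' (x : HallAlgebra k) : x * 1 = x := by
  rw [mul_def, one_def]
  refine induction (p := fun x => mulLin x (basis zeroClass) = x) x (by simp)
    (fun x x' h h' => by simp [h, h']) fun r a => ?_
  rw [map_smul, LinearMap.smul_apply, ← mul_def, basis_mul_basis, basisMul_zero_right]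
  rfl

noncomputable instance : Ring (HallAlgebra k) :=
  { (inferInstance : AddCommGroup (HallAlgebra k)) with
    mul := (· * ·)
    one := 1
    left_distrib := fun x y z => by simp only [mul_def, map_add]
    right_distrib := fun x y z => by simp only [mul_def, map_add, LinearMap.add_apply]
    zero_mul := fun x => by simp only [mul_def, map_zero, LinearMap.zero_apply]
    mul_zero := fun x => by simp only [mul_def, map_zero]
    mul_assoc := HallAlgebra.mul_assoc'
    one_mul := HallAlgebra.one_mul'
    mul_one := HallAlgebra.mul_one' }

noncomputable instance : Algebra (QV k) (HallAlgebra k) :=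
  Algebra.ofModule (fun r x y => by simp only [mul_def, map_smul, LinearMap.smul_apply])
    (fun r x y => by simp only [mul_def, map_smul])

/-- The coordinates of an element in the basis of isomorphism classes. -/
noncomputable def coord (L : FGModuleCat.{u} k[ε]) : HallAlgebra k →ₗ[QV k] QV k :=
  Finsupp.lapply (M := QV k) (⟦L⟧ : IsoClass k)

/-- The coefficient of `[L]` in `[M] * [N]`. -/
theorem coord_cls_mul_cls (M N L : FGModuleCat.{u} k[ε]) :
    coord L (cls M * cls N) = structConst M N L := by
  rw [cls, cls, ← isoConst_mk, basis_mul_basis]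
  rfl

end HallAlgebra

theorem eulerForm_comm (M N : FGModuleCat.{u} k[ε]) : eulerForm M N = eulerForm N M :=
  mul_comm _ _

theorem structConst_swap (K M L : FGModuleCat.{u} k[ε]) (hK : HasProjectiveDimensionLE K.obj 1) :
    structConst K M L = structConst M K L := by
  have : Module.Finite k[ε] K.obj := K.property
  obtain ⟨n, ⟨e⟩⟩ := exists_equiv_free (k := k) K.obj
  rw [structConst, structConst, eulerForm_comm, card_extMiddle_swap K.obj M.obj L.obj e,
    Nat.card_congr (ModuleCat.homEquiv (M := K.obj) (N := M.obj)),
    Nat.card_congr (ModuleCat.homEquiv (M := M.obj) (N := K.obj)), card_hom_swap _ _ e]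

namespace HallAlgebra

/-- The classes of the modules of projective dimension at most one are central. -/
theorem cls_commute (K : FGModuleCat.{u} k[ε]) (hK : HasProjectiveDimensionLE K.obj 1)
    (x : HallAlgebra k) : cls K * x = x * cls K := by
  refine induction (p := fun x => cls K * x = x * cls K) x (by simp)
    (fun x y hx hy => by rw [mul_add, add_mul, hx, hy]) fun r a => ?_
  rw [mul_smul_comm, smul_mul_assoc]
  congr 1
  rw [cls, basis_mul_basis, basis_mul_basis]
  refine Finsupp.ext fun c => ?_
  rw [basisMul_apply, basisMul_apply, ← Quotient.out_eq a, ← Quotient.out_eq c, isoConst_mk,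
    isoConst_mk]
  exact structConst_swap _ _ _ hK

end HallAlgebra

open HallAlgebra in
/-- The generators `[K] - [K']` and `[L] - [K ⊕ M]` of the defining ideal, where `K`, `K'` have
projective dimension at most one. For a split `ı`quiver with one vertex and no arrows, the
subalgebra `ℍ` of `Λ` is `Λ` itself, so that `res_ℍ K ≅ res_ℍ K'` means `K ≅ K'`. -/
inductive SDRel : HallAlgebra k → HallAlgebra k → Prop
  | iso (K K' : FGModuleCat.{u} k[ε]) (hK : HasProjectiveDimensionLE K.obj 1)
      (hK' : HasProjectiveDimensionLE K'.obj 1) (h : Nonempty (K ≅ K')) : SDRel (cls K) (cls K')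
  | ses (K L M : FGModuleCat.{u} k[ε]) (hK : HasProjectiveDimensionLE K.obj 1)
      (f : K.obj ⟶ L.obj) (g : L.obj ⟶ M.obj) (w : f ≫ g = 0)
      (h : (ShortComplex.mk f g w).ShortExact) :
      SDRel (cls L) (cls (FGModuleCat.of k[ε] (K.obj × M.obj)))

variable (k) in
/-- The quotient of the twisted Hall algebra by the ideal generated by the above elements. -/
abbrev HallQuotient : Type (u + 1) := RingQuot (SDRel (k := k))

/-- The quotient map. -/
noncomputable def toQuotient : HallAlgebra k →ₐ[QV k] HallQuotient k :=
  RingQuot.mkAlgHom (QV k) SDRel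

variable (k) in
/-- The multiplicative set generated by the `a [K]`, where `a` is a nonzero rational number and
`K` has projective dimension at most one. -/
noncomputable def denominators : Submonoid (HallQuotient k) :=
  Submonoid.closure {x | ∃ (a : ℚ) (K : FGModuleCat.{u} k[ε]), a ≠ 0 ∧
    HasProjectiveDimensionLE K.obj 1 ∧ x = (a : QV k) • toQuotient (HallAlgebra.cls K)}

theorem denominators_commute (s : denominators k) (r : HallQuotient k) :
    (s : HallQuotient k) * r = r * s := by
  obtain ⟨s, hs⟩ := s
  have hle : denominators k ≤ Submonoid.center (HallQuotient k) := by
    rw [denominators, Submonoid.closure_le]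
    rintro _ ⟨a, K, -, hK, rfl⟩
    rw [SetLike.mem_coe, Submonoid.mem_center_iff]
    intro r
    obtain ⟨x, rfl⟩ := RingQuot.mkAlgHom_surjective (QV k) SDRel r
    rw [mul_smul_comm, smul_mul_assoc]
    congr 1
    exact (map_mul toQuotient _ _).symm.trans
      ((congrArg toQuotient (HallAlgebra.cls_commute K hK x).symm).trans (map_mul toQuotient _ _))
  exact (Submonoid.mem_center_iff.1 (hle hs) r).symm

noncomputable instance : OreLocalization.OreSet (denominators k) where
  ore_right_cancel := fun r₁ r₂ s h => ⟨s, by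
    rw [denominators_commute, denominators_commute]; exact h⟩
  oreNum := fun r _ => r
  oreDenom := fun _ s => s
  ore_eq := fun r s => denominators_commute s r

variable (k) in
/-- The `ı`Hall algebra (twisted semi-derived Ringel-Hall algebra) of `Λ = k[x]/(x²)`, an algebra
over `ℚ(v)`. -/
abbrev IHallAlgebra : Type (u + 1) := OreLocalization (denominators k) (HallQuotient k)

/-- The element `[M]` of the `ı`Hall algebra. -/
noncomputable def cls (M : FGModuleCat.{u} k[ε]) : IHallAlgebra k :=
  OreLocalization.numeratorHom (S := denominators k) (toQuotient (HallAlgebra.cls M))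

variable (k) in
/-- The module `nS`, the direct sum of `n` copies of the simple module `S = k[ε]/(ε)`. -/
noncomputable def nS (n : ℕ) : FGModuleCat.{u} k[ε] :=
  FGModuleCat.of k[ε] (Fin n → k[ε] ⧸ Ideal.span {(ε : k[ε])})

variable (k) in
/-- The generalized simple module `𝕂 = k[ε]`. -/
noncomputable def bbK : FGModuleCat.{u} k[ε] := FGModuleCat.of k[ε] k[ε]

variable (k) in
/-- The quantum integer `[n] = (v ^ n - v ^ (-n)) / (v - v⁻¹)`. -/
noncomputable def qInt (n : ℕ) : QV k := (v k ^ n - (v k)⁻¹ ^ n) / (v k - (v k)⁻¹)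

variable (k) in
/-- The quantum factorial `[n]! = [1] [2] ⋯ [n]`. -/
noncomputable def qFact (n : ℕ) : QV k := ∏ i ∈ Finset.range n, qInt k (i + 1)

variable (k) in
/-- The quantum double factorial `[2n]!! = [2] [4] ⋯ [2n]`, with `[0]!! = 1`. -/
noncomputable def qDoubleFact (n : ℕ) : QV k := ∏ i ∈ Finset.range n, qInt k (2 * (i + 1))

variable (k) in
/-- The factor `[S]² + v⁻¹ (v² - 1)² [m]² [𝕂]`. -/
noncomputable def factor (m : ℕ) : IHallAlgebra k :=
  cls (nS k 1) ^ 2 + ((v k)⁻¹ * (v k ^ 2 - 1) ^ 2 * qInt k m ^ 2) • cls (bbK k)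

variable (k) in
/-- The `ı`divided power `[S]^{(n)}` of parity `1̄`, where `m = ⌊n / 2⌋`: it is `1 / [n]!` times
the product of the factors with `[1], [3], …, [2m - 1]`, and times `[S]` on the left if `n`
is odd. -/
noncomputable def iDivPowOdd (n : ℕ) : IHallAlgebra k :=
  (qFact k n)⁻¹ • (cls (nS k 1) ^ (n % 2) *
    ((List.range (n / 2)).map fun j => factor k (2 * j + 1)).prod)

variable (k) in
/-- The `ı`divided power `[S]^{(n)}` of parity `0̄`: for `n = 2m + 1` it is `1 / [n]!` times `[S]`
times the product of the factors with `[2], [4], …, [2m]`, and for `n = 2m` it is `1 / [n]!` times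
the product of the factors with `[0], [2], …, [2m - 2]`. -/
noncomputable def iDivPowEven (n : ℕ) : IHallAlgebra k :=
  (qFact k n)⁻¹ • (cls (nS k 1) ^ (n % 2) *
    ((List.range (n / 2)).map fun j => factor k (2 * j + 2 * (n % 2))).prod)

end Algebra

end IHall

/-! Everything rests on one product. Since `ε` kills `S` and `nS`, pushing out `0 → S → 𝕂 → S → 0`
identifies `Hom(S, nS)`, a set of `q ^ n` elements, with `Ext¹(S, nS)` (`bijective_cls_comp`). The
zero class has middle term `(n+1)S`. A nonzero map `S → nS` is a split injection, so each of the
other `q ^ n - 1` classes has middle term `𝕂 ⊕ (n-1)S` (`extMiddle_prod`). The twist together with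
`|Hom(S, nS)|` contributes `v ^ n / q ^ n = v ^ (-n)`, whence `[S] * [nS] = v ^ (-n) [(n+1)S] + (v ^
n - v ^ (-n)) [(n-1)S] * [𝕂]` (`cls_nS_mul`). Here `𝕂` is free of rank one, so `[𝕂]` is central and
`[𝕂] * [M] = [𝕂 ⊕ M]` with no scalar. All this holds already in the twisted Hall algebra, and the
ring map `toIHall` carries it over; nothing else about the quotient and the localization is needed.

The rest is formal and takes place in any `ℚ(v)`-algebra with elements `x n` and `K` that obey this
rule, with `x 0 = 1` and `x 1` commuting with `K`. Let `D_σ(n)` (`divSum`) be `[n]!` times the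
proposed sum, with `j (j + σ)` in the exponent of `v`. For the parity `0̄` the sign `σ` is `-1` for
even `n` and `1` for odd `n`; for `1̄` it is the opposite. With `c = v⁻¹ (v² - 1)²`, comparing
coefficients gives `D_{-1}(n+1) = x 1 * D_1(n)` and `D_1(n+1) = x 1 * D_{-1}(n) + c [n]² D_1(n-1) *
K`, both of which come down to the addition rule `[a + b] = v ^ b [a] + v ^ (-a) [b]`
(`divCoeff_neg_one_succ`, `divCoeff_one_succ`). The products defining the `ı`divided powers obey the
same recursions: a step to `σ = -1` only multiplies by `[S]` (for `0̄` because the factor with `[0]`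
is just `[S]²`), and a step to `σ = 1` brings in a new factor. Induction then identifies them with
the sums (`prod_eq_divSum_even`, `prod_eq_divSum_odd`). -/

namespace IHall

/-! ### Quantum integers and the recursions for the coefficients -/

section QuantumIntegers

variable {k : Type u} [Finite k]

theorem v_ne_zero_of_nonempty [Nonempty k] : v k ≠ 0 := fun h => by
  have h1 := v_sq k
  have h2 : (Nat.card k : QV k) ≠ 0 := Nat.cast_ne_zero.2 Nat.card_pos.ne'
  exact h2 (by rw [← h1, h]; simp)

/-- `v` is not a root of unity: `v ^ n = v ^ (-n)` would give `q ^ n = 1` with `q > 1`. This makes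
all quantum integers `[n]` with `n ≠ 0` invertible. -/
theorem v_pow_sub_inv_pow_ne_zero [Nontrivial k] {n : ℕ} (hn : n ≠ 0) :
    v k ^ n - (v k)⁻¹ ^ n ≠ 0 := by
  intro h
  have hv : v k ^ n ≠ 0 := pow_ne_zero _ v_ne_zero_of_nonempty
  have h1 : (v k ^ 2) ^ n = 1 := by
    rw [inv_pow, sub_eq_zero] at h
    rw [← pow_mul, mul_comm, pow_mul, sq]
    nth_rw 1 [h]
    exact inv_mul_cancel₀ hv
  rw [v_sq, ← Nat.cast_pow, Nat.cast_eq_one] at h1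
  exact (Nat.one_lt_pow hn Finite.one_lt_card).ne' h1

theorem v_sub_inv_ne_zero [Nontrivial k] : v k - (v k)⁻¹ ≠ 0 := by
  simpa using v_pow_sub_inv_pow_ne_zero (k := k) one_ne_zero

theorem qInt_ne_zero [Nontrivial k] {n : ℕ} (hn : n ≠ 0) : qInt k n ≠ 0 :=
  div_ne_zero (v_pow_sub_inv_pow_ne_zero hn) v_sub_inv_ne_zero

theorem qFact_ne_zero [Nontrivial k] (n : ℕ) : qFact k n ≠ 0 :=
  Finset.prod_ne_zero_iff.2 fun i _ => qInt_ne_zero i.succ_ne_zero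

theorem qDoubleFact_ne_zero [Nontrivial k] (n : ℕ) : qDoubleFact k n ≠ 0 :=
  Finset.prod_ne_zero_iff.2 fun i _ => qInt_ne_zero (by omega)

omit [Finite k] in
theorem qFact_succ (n : ℕ) : qFact k (n + 1) = qFact k n * qInt k (n + 1) :=
  Finset.prod_range_succ _ _

omit [Finite k] in
theorem qDoubleFact_succ (n : ℕ) :
    qDoubleFact k (n + 1) = qDoubleFact k n * qInt k (2 * (n + 1)) :=
  Finset.prod_range_succ _ _

variable (k) in
/-- The coefficient of `[(n - 2j)S] * [𝕂]^j` in `[n]!` times an `ı`divided power. -/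
noncomputable def divCoeff (σ : ℤ) (n j : ℕ) : QV k :=
  if 2 * j ≤ n then
    qFact k n * (v k ^ ((j : ℤ) * ((j : ℤ) + σ) - ((n - 2 * j).choose 2 : ℕ)) *
      (v k - (v k)⁻¹) ^ j / (qFact k (n - 2 * j) * qDoubleFact k j))
  else 0

omit [Finite k] in
theorem divCoeff_of_lt (σ : ℤ) {n j : ℕ} (h : n < 2 * j) : divCoeff k σ n j = 0 :=
  if_neg (by omega)

omit [Finite k] in
theorem divCoeff_add (σ : ℤ) (m j : ℕ) : divCoeff k σ (m + 2 * j) j =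
    qFact k (m + 2 * j) * (v k ^ ((j : ℤ) * ((j : ℤ) + σ) - (m.choose 2 : ℕ)) *
      (v k - (v k)⁻¹) ^ j / (qFact k m * qDoubleFact k j)) := by
  rw [divCoeff, if_pos (by omega), Nat.add_sub_cancel]

theorem divCoeff_zero_right [Nontrivial k] (σ : ℤ) (n : ℕ) :
    divCoeff k σ n 0 = v k ^ (-(n.choose 2 : ℤ)) := by
  have := divCoeff_add (k := k) σ n 0
  have h := qFact_ne_zero (k := k) n
  simp only [mul_zero, add_zero] at this
  rw [this]
  simp [qDoubleFact]
  field_simp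

theorem divCoeff_succ_zero [Nontrivial k] (σ τ : ℤ) (n : ℕ) :
    divCoeff k σ (n + 1) 0 = v k ^ (-(n : ℤ)) * divCoeff k τ n 0 := by
  rw [divCoeff_zero_right, divCoeff_zero_right, ← zpow_add₀ v_ne_zero_of_nonempty,
    Nat.choose_succ_succ' n 1, Nat.choose_one_right]
  push_cast
  ring_nf

/-- Writes `1 / [m-1]!` as `[m] / [m]!` and uses `(m choose 2) = (m-1) + (m-1 choose 2)`. In this
form `m = 0` needs no exception: the coefficient is zero by convention on the left and `[0] = 0` on
the right. -/
theorem zpow_mul_divCoeff_succ [Nontrivial k] (σ : ℤ) (m j : ℕ) :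
    v k ^ (1 - (m : ℤ)) * divCoeff k σ (m + 2 * j + 1) (j + 1) =
      qFact k (m + 2 * j + 1) * (v k ^ ((j + 1 : ℤ) * ((j + 1 : ℤ) + σ) - (m.choose 2 : ℕ)) *
        (v k - (v k)⁻¹) ^ (j + 1) * qInt k m / (qFact k m * qDoubleFact k (j + 1))) := by
  rcases m with _ | m
  · rw [divCoeff_of_lt _ (by omega)]
    simp [qInt]
  · have hm := qInt_ne_zero (k := k) m.succ_ne_zero
    have hz : v k ^ ((j + 1 : ℤ) * ((j + 1 : ℤ) + σ) - ((m + 1).choose 2 : ℕ)) =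
        v k ^ (1 - ((m + 1 : ℕ) : ℤ)) *
          v k ^ (((j + 1 : ℕ) : ℤ) * (((j + 1 : ℕ) : ℤ) + σ) - (m.choose 2 : ℕ)) := by
      rw [← zpow_add₀ v_ne_zero_of_nonempty, Nat.choose_succ_succ' m 1, Nat.choose_one_right]
      push_cast
      ring_nf
    rw [show m + 1 + 2 * j + 1 = m + 2 * (j + 1) by ring, divCoeff_add, qFact_succ m, hz]
    generalize v k ^ (1 - ((m + 1 : ℕ) : ℤ)) = y
    rw [Nat.succ_eq_add_one] at hm
    field_simp

/-- Coefficient form of `D_{-1}(n+1) = x 1 * D_1(n)`. With `n = m + 2j + 1`, cancelling common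
factors leaves the addition rule for `[m + (2j+2)]`. -/
theorem divCoeff_neg_one_succ [Nontrivial k] (n j : ℕ) :
    divCoeff k (-1) (n + 1) (j + 1) =
      v k ^ (2 * (j + 1 : ℤ) - n) * divCoeff k 1 n (j + 1) +
        (v k ^ ((n : ℤ) - 2 * j) - v k ^ (2 * (j : ℤ) - n)) * divCoeff k 1 n j := by
  -- Outside the range of summation the coefficients vanish, except for `divCoeff k 1 n j` when `n =
  -- 2j`, whose multiplier is then `v ^ 0 - v ^ 0`.
  rcases lt_or_ge n (2 * j + 1) with h | h
  · rw [divCoeff_of_lt _ (by omega), divCoeff_of_lt _ (by omega)]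
    rcases Nat.lt_succ_iff_lt_or_eq.1 h with h | rfl
    · rw [divCoeff_of_lt _ h]; ring
    · simp
  obtain ⟨m, rfl⟩ := Nat.exists_eq_add_of_le' h
  have hv : v k ≠ 0 := v_ne_zero_of_nonempty
  have hd : v k - (v k)⁻¹ ≠ 0 := v_sub_inv_ne_zero
  have hm := qInt_ne_zero (k := k) (n := m + 1) (by omega)
  have hj := qInt_ne_zero (k := k) (n := 2 * (j + 1)) (by omega)
  have hF := qFact_ne_zero (k := k) m
  have hH := qDoubleFact_ne_zero (k := k) j
  -- This supplies the missing factor `v - v⁻¹`, and its `[m+1]` turns `1 / [m+1]!` into `1 / [m]!`.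
  have e1 : v k ^ ((m : ℤ) + 1) - v k ^ (-(m : ℤ) - 1) = qInt k (m + 1) * (v k - (v k)⁻¹) := by
    rw [qInt, div_mul_cancel₀ _ hd, inv_pow, ← zpow_natCast, ← zpow_neg]
    push_cast
    ring_nf
  have e2 : qInt k (m + 2 * j + 2) =
      qInt k m * v k ^ (2 * (j + 1)) + qInt k (2 * (j + 1)) * (v k)⁻¹ ^ m := by
    simp only [qInt]
    field_simp
    ring
  rw [show m + (2 * j + 1) + 1 = m + 2 * (j + 1) by ring, divCoeff_add,
    show 2 * (j + 1 : ℤ) - (m + (2 * j + 1) : ℕ) = 1 - m by push_cast; ring,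
    ← add_assoc m, zpow_mul_divCoeff_succ, show m + 2 * (j + 1) = m + 2 * j + 1 + 1 by ring,
    qFact_succ (m + 2 * j + 1), show m + 2 * j + 1 = m + 1 + 2 * j by ring, divCoeff_add,
    show ((m + 1 + 2 * j : ℕ) : ℤ) - 2 * j = m + 1 by push_cast; ring,
    show 2 * (j : ℤ) - ((m + 1 + 2 * j : ℕ) : ℤ) = -m - 1 by push_cast; ring, e1,
    show m + 1 + 2 * j + 1 = m + 2 * j + 2 by ring, e2, qFact_succ m, qDoubleFact_succ,
    Nat.choose_succ_succ' m 1, Nat.choose_one_right]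
  -- The three powers of `v` are expressed through the single power `v ^ (j (j+1) - (m choose 2))`,
  -- so that it can be cancelled.
  have z1 : v k ^ (((j + 1 : ℕ) : ℤ) * (((j + 1 : ℕ) : ℤ) + -1) - (m.choose 2 : ℕ)) =
      v k ^ ((j : ℤ) * (j + 1) - (m.choose 2 : ℕ)) := by push_cast; ring_nf
  have z2 : v k ^ ((j + 1 : ℤ) * ((j + 1 : ℤ) + 1) - (m.choose 2 : ℕ)) =
      v k ^ ((j : ℤ) * (j + 1) - (m.choose 2 : ℕ)) * v k ^ (2 * (j + 1)) := by
    rw [← zpow_natCast, ← zpow_add₀ hv]; push_cast; ring_nf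
  have z3 : v k ^ ((j : ℤ) * ((j : ℤ) + 1) - (m + m.choose (1 + 1) : ℕ)) =
      v k ^ ((j : ℤ) * (j + 1) - (m.choose 2 : ℕ)) * (v k)⁻¹ ^ m := by
    rw [← zpow_natCast, inv_zpow', ← zpow_add₀ hv]; push_cast; ring_nf
  rw [z1, z2, z3]
  generalize v k ^ ((j : ℤ) * (j + 1) - (m.choose 2 : ℕ)) = Z
  generalize qInt k (2 * (j + 1)) = a at *
  generalize qInt k (m + 1) = b at *
  generalize qInt k m = c at *
  generalize v k - (v k)⁻¹ = d at *
  field_simp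
  ring

/-- Coefficient form of the recursion for `D_1(n+1)`. The truncation in `n - 1` is harmless, since
at `n = 0` that term carries `[0]² = 0`. -/
theorem divCoeff_one_succ [Nontrivial k] (n j : ℕ) :
    divCoeff k 1 (n + 1) (j + 1) =
      v k ^ (2 * (j + 1 : ℤ) - n) * divCoeff k (-1) n (j + 1) +
        (v k ^ ((n : ℤ) - 2 * j) - v k ^ (2 * (j : ℤ) - n)) * divCoeff k (-1) n j +
        (v k)⁻¹ * (v k ^ 2 - 1) ^ 2 * qInt k n ^ 2 * divCoeff k 1 (n - 1) j := by
  rcases lt_or_ge n (2 * j + 1) with h | h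
  · rw [divCoeff_of_lt _ (by omega), divCoeff_of_lt _ (by omega)]
    rcases n with _ | n
    · rcases Nat.lt_succ_iff_lt_or_eq.1 h with h | h
      · rw [divCoeff_of_lt _ h]; simp [qInt]
      · simp [qInt, show j = 0 by omega]
    rw [divCoeff_of_lt _ (show n + 1 - 1 < 2 * j by omega)]
    rcases Nat.lt_succ_iff_lt_or_eq.1 h with h | h
    · rw [divCoeff_of_lt _ h]; ring
    · simp [h]
  obtain ⟨m, rfl⟩ := Nat.exists_eq_add_of_le' h
  have hv : v k ≠ 0 := v_ne_zero_of_nonempty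
  have hd : v k - (v k)⁻¹ ≠ 0 := v_sub_inv_ne_zero
  have hm := qInt_ne_zero (k := k) (n := m + 1) (by omega)
  have hj := qInt_ne_zero (k := k) (n := 2 * (j + 1)) (by omega)
  have hF := qFact_ne_zero (k := k) m
  have hH := qDoubleFact_ne_zero (k := k) j
  have e1 : v k ^ ((m : ℤ) + 1) - v k ^ (-(m : ℤ) - 1) = qInt k (m + 1) * (v k - (v k)⁻¹) := by
    rw [qInt, div_mul_cancel₀ _ hd, inv_pow, ← zpow_natCast, ← zpow_neg]
    push_cast
    ring_nf
  -- The bracket equals `v ^ (m+2j+2)`, so this is the addition rule `[m + b] v ^ b = [m] + [b] v ^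
  -- (m+b)` with `b = 2j+2`. The bracket is kept split because its two summands come from different
  -- terms of the recursion: `x 1 * D_{-1}(n)` and the term with `[n]²`.
  have e2 : qInt k (m + 2 * j + 2) * v k ^ (2 * (j + 1)) =
      qInt k m + qInt k (2 * (j + 1)) * ((v k)⁻¹ ^ (m + 2 * j) +
        qInt k (m + 2 * j + 1) * (v k - (v k)⁻¹) * v k) := by
    simp only [qInt, div_mul_cancel₀ _ hd]
    generalize v k - (v k)⁻¹ = d at *
    rw [div_mul_eq_mul_div, div_mul_eq_mul_div, ← add_div]
    congr 1
    simp only [inv_pow]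
    field_simp
    ring
  have e3 : (v k)⁻¹ * (v k ^ 2 - 1) ^ 2 = (v k - (v k)⁻¹) ^ 2 * v k := by
    field_simp
  have z1 : v k ^ (((j + 1 : ℕ) : ℤ) * (((j + 1 : ℕ) : ℤ) + 1) - (m.choose 2 : ℕ)) =
      v k ^ ((j : ℤ) * (j + 1) - (m.choose 2 : ℕ)) * v k ^ (2 * (j + 1)) := by
    rw [← zpow_natCast, ← zpow_add₀ hv]; push_cast; ring_nf
  have z2 : v k ^ ((j + 1 : ℤ) * ((j + 1 : ℤ) + -1) - (m.choose 2 : ℕ)) =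
      v k ^ ((j : ℤ) * (j + 1) - (m.choose 2 : ℕ)) := by ring_nf
  have z3 : v k ^ ((j : ℤ) * ((j : ℤ) + -1) - (m + m.choose (1 + 1) : ℕ)) =
      v k ^ ((j : ℤ) * (j + 1) - (m.choose 2 : ℕ)) * (v k)⁻¹ ^ (m + 2 * j) := by
    rw [← zpow_natCast, inv_zpow', ← zpow_add₀ hv]; push_cast; ring_nf
  rw [show m + (2 * j + 1) + 1 = m + 2 * (j + 1) by ring, divCoeff_add,
    show 2 * (j + 1 : ℤ) - (m + (2 * j + 1) : ℕ) = 1 - m by push_cast; ring,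
    ← add_assoc m, zpow_mul_divCoeff_succ, show m + 2 * (j + 1) = m + 2 * j + 1 + 1 by ring,
    qFact_succ (m + 2 * j + 1), Nat.add_sub_cancel, divCoeff_add,
    show m + 2 * j + 1 = m + 1 + 2 * j by ring, divCoeff_add,
    show ((m + 1 + 2 * j : ℕ) : ℤ) - 2 * j = m + 1 by push_cast; ring,
    show 2 * (j : ℤ) - ((m + 1 + 2 * j : ℕ) : ℤ) = -m - 1 by push_cast; ring, e1,
    show m + 1 + 2 * j = m + 2 * j + 1 by ring, qFact_succ (m + 2 * j), qFact_succ m,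
    qDoubleFact_succ, Nat.choose_succ_succ' m 1, Nat.choose_one_right, z1, z2, z3, e3]
  have hn := qFact_ne_zero (k := k) (m + 2 * j)
  generalize v k ^ ((j : ℤ) * (j + 1) - (m.choose 2 : ℕ)) = Z
  have e4 : v k ^ (2 * (j + 1)) * qInt k (m + 2 * j + 1 + 1) =  _ := (mul_comm _ _).trans e2
  generalize qInt k (2 * (j + 1)) = a at *
  generalize qInt k (m + 1) = b at *
  generalize qInt k m = c at *
  generalize qInt k (m + 2 * j + 1) = p at *
  generalize qInt k (m + 2 * j + 1 + 1) = r at *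
  generalize v k - (v k)⁻¹ = d at *
  generalize (v k)⁻¹ ^ (m + 2 * j) = Y at *
  generalize v k ^ (2 * (j + 1)) = X at *
  field_simp
  linear_combination p * d * Z * d ^ j * e4

end QuantumIntegers

/-! ### The recursions for the sums and for the products of factors, in an abstract algebra -/

section Recursion

variable {k : Type u} [Finite k] [Nontrivial k] {A : Type*} [Ring A] [Algebra (QV k) A]

variable (k) in
/-- The sum `∑ⱼ divCoeff σ n j • (x (n - 2j) * K ^ j)`. -/
noncomputable def divSum (x : ℕ → A) (K : A) (σ : ℤ) (n : ℕ) : A :=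
  ∑ j ∈ Finset.range (n / 2 + 1), divCoeff k σ n j • (x (n - 2 * j) * K ^ j)

omit [Finite k] [Nontrivial k] in
-- As the coefficients vanish for `2j > n`, the range may be enlarged freely; sums for different `n`
-- can thus be compared over one range.
theorem divSum_eq_sum_range (x : ℕ → A) (K : A) (σ : ℤ) {n N : ℕ} (h : n < 2 * N) :
    divSum k x K σ n =
      ∑ j ∈ Finset.range N, divCoeff k σ n j • (x (n - 2 * j) * K ^ j) := by
  refine Finset.sum_subset (Finset.range_subset_range.2 (by omega)) fun j _ hj => ?_
  rw [Finset.mem_range] at hj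
  rw [divCoeff_of_lt _ (by omega), zero_smul]

variable {x : ℕ → A} {K : A}

omit [Finite k] [Nontrivial k] in
-- Each term `x (n-2j) * K ^ j` contributes in degrees `j` and `j + 1` of `K`. The result is sorted
-- by powers of `K`, with the power `0` split off.
theorem mul_divSum (hx : ∀ n : ℕ, x 1 * x n = v k ^ (-(n : ℤ)) • x (n + 1) +
      (v k ^ (n : ℤ) - v k ^ (-(n : ℤ))) • (x (n - 1) * K)) (σ : ℤ) (n : ℕ) :
    x 1 * divSum k x K σ n = (v k ^ (-(n : ℤ)) * divCoeff k σ n 0) • x (n + 1) +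
      ∑ j ∈ Finset.range (n + 1), (v k ^ (2 * (j + 1 : ℤ) - n) * divCoeff k σ n (j + 1) +
        (v k ^ ((n : ℤ) - 2 * j) - v k ^ (2 * (j : ℤ) - n)) * divCoeff k σ n j) •
        (x (n + 1 - 2 * (j + 1)) * K ^ (j + 1)) := by
  have key : ∀ j : ℕ, x 1 * divCoeff k σ n j • (x (n - 2 * j) * K ^ j) =
      (v k ^ (2 * (j : ℤ) - n) * divCoeff k σ n j) • (x (n + 1 - 2 * j) * K ^ j) +
      ((v k ^ ((n : ℤ) - 2 * j) - v k ^ (2 * (j : ℤ) - n)) * divCoeff k σ n j) •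
        (x (n + 1 - 2 * (j + 1)) * K ^ (j + 1)) := by
    intro j
    rcases lt_or_ge n (2 * j) with h | h
    · simp [divCoeff_of_lt σ h]
    · obtain ⟨m, rfl⟩ := Nat.exists_eq_add_of_le' h
      rw [mul_smul_comm, ← mul_assoc, Nat.add_sub_cancel, hx,
        show m + 2 * j + 1 - 2 * j = m + 1 by omega,
        show m + 2 * j + 1 - 2 * (j + 1) = m - 1 by omega, add_mul, smul_mul_assoc, smul_mul_assoc,
        mul_assoc (x (m - 1)), ← pow_succ', smul_add, smul_smul, smul_smul]
      push_cast
      ring_nf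
  rw [divSum_eq_sum_range x K σ (show n < 2 * (n + 1) by omega), Finset.mul_sum,
    Finset.sum_congr rfl fun j _ => key j, Finset.sum_add_distrib]
  simp only [add_smul, Finset.sum_add_distrib]
  rw [← add_assoc]
  congr 1
  -- Shift of the index in the first half of the terms; the top term `j = n + 1` that this requires
  -- has coefficient zero.
  have := Finset.sum_range_succ' (fun j : ℕ => (v k ^ (2 * (j : ℤ) - n) * divCoeff k σ n j) •
    (x (n + 1 - 2 * j) * K ^ j)) (n + 1)
  rw [Finset.sum_range_succ, divCoeff_of_lt σ (show n < 2 * (n + 1) by omega)] at this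
  simp only [mul_zero, zero_smul, add_zero] at this
  rw [this]
  simp [add_comm]

theorem divSum_neg_one_succ (hx : ∀ n : ℕ, x 1 * x n = v k ^ (-(n : ℤ)) • x (n + 1) +
      (v k ^ (n : ℤ) - v k ^ (-(n : ℤ))) • (x (n - 1) * K)) (n : ℕ) :
    divSum k x K (-1) (n + 1) = x 1 * divSum k x K 1 n := by
  rw [mul_divSum hx, divSum_eq_sum_range x K _ (show n + 1 < 2 * (n + 2) by omega),
    Finset.sum_range_succ', add_comm]
  simp only [mul_zero, pow_zero, mul_one, Nat.sub_zero, divCoeff_succ_zero (-1) 1,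
    divCoeff_neg_one_succ]

theorem divSum_one_succ (hx : ∀ n : ℕ, x 1 * x n = v k ^ (-(n : ℤ)) • x (n + 1) +
      (v k ^ (n : ℤ) - v k ^ (-(n : ℤ))) • (x (n - 1) * K)) (n : ℕ) :
    divSum k x K 1 (n + 1) = x 1 * divSum k x K (-1) n +
      ((v k)⁻¹ * (v k ^ 2 - 1) ^ 2 * qInt k n ^ 2) • (divSum k x K 1 (n - 1) * K) := by
  rw [mul_divSum hx, divSum_eq_sum_range x K _ (show n + 1 < 2 * (n + 2) by omega),
    divSum_eq_sum_range x K _ (show n - 1 < 2 * (n + 1) by omega),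
    Finset.sum_range_succ', add_comm, add_assoc, Finset.sum_mul, Finset.smul_sum,
    ← Finset.sum_add_distrib]
  simp only [mul_zero, pow_zero, mul_one, Nat.sub_zero, divCoeff_succ_zero 1 (-1),
    divCoeff_one_succ]
  congr 1
  refine Finset.sum_congr rfl fun j _ => ?_
  rw [smul_mul_assoc, mul_assoc (x _), ← pow_succ, smul_smul,
    show n + 1 - 2 * (j + 1) = n - 1 - 2 * j by omega, ← add_smul]

variable (k) in
/-- The factor `s² + v⁻¹ (v² - 1)² [m]² K`. -/
noncomputable def divFactor (s K : A) (m : ℕ) : A :=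
  s ^ 2 + ((v k)⁻¹ * (v k ^ 2 - 1) ^ 2 * qInt k m ^ 2) • K

omit [Finite k] [Nontrivial k] in
theorem commute_prod_divFactor {s K t : A} (hs : Commute t s) (hK : Commute t K) (l : List ℕ) :
    Commute t (l.map (divFactor k s K)).prod := by
  refine Commute.list_prod_right _ _ fun y hy => ?_
  obtain ⟨m, -, rfl⟩ := List.mem_map.1 hy
  exact (hs.pow_right 2).add_right (hK.smul_right _)

omit [Finite k] [Nontrivial k] in
-- The new factor stands on the right. As `s` commutes with `K`, it commutes with the old product,
-- so `s²` can be moved to the left, where the recursion for the sums has it.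
theorem prod_divFactor_succ {s K : A} (hK : Commute s K) (g : ℕ → ℕ) (n : ℕ) :
    ((List.range (n + 1)).map fun j => divFactor k s K (g j)).prod =
      s * (s * ((List.range n).map fun j => divFactor k s K (g j)).prod) +
      ((v k)⁻¹ * (v k ^ 2 - 1) ^ 2 * qInt k (g n) ^ 2) •
        (((List.range n).map fun j => divFactor k s K (g j)).prod * K) := by
  have h := commute_prod_divFactor (k := k) (Commute.refl s) hK ((List.range n).map g)
  rw [List.map_map] at h
  change Commute s ((List.range n).map fun j => divFactor k s K (g j)).prod at h
  rw [List.range_succ, List.map_append, List.prod_append, List.map_singleton, List.prod_singleton]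
  conv_lhs => rw [divFactor]
  rw [mul_add, mul_smul_comm, ← (h.pow_left 2).eq, sq, mul_assoc]

/-- The parity `0̄`, even and odd `n` together. The even claim for `n + 1` follows from the odd
claim for `n`, and the odd claims form an induction of their own. -/
theorem prod_eq_divSum_even (hx : ∀ n : ℕ, x 1 * x n = v k ^ (-(n : ℤ)) • x (n + 1) +
      (v k ^ (n : ℤ) - v k ^ (-(n : ℤ))) • (x (n - 1) * K)) (h0 : x 0 = 1)
    (hK : Commute (x 1) K) (n : ℕ) :
    ((List.range n).map fun j => divFactor k (x 1) K (2 * j)).prod = divSum k x K (-1) (2 * n) ∧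
    x 1 * ((List.range n).map fun j => divFactor k (x 1) K (2 * j + 2)).prod =
      divSum k x K 1 (2 * n + 1) := by
  have hstep : ∀ n, x 1 * ((List.range n).map fun j => divFactor k (x 1) K (2 * j + 2)).prod =
      divSum k x K 1 (2 * n + 1) →
      ((List.range (n + 1)).map fun j => divFactor k (x 1) K (2 * j)).prod =
        divSum k x K (-1) (2 * (n + 1)) := by
    intro n ih
    -- The first factor belongs to `[0] = 0` and is therefore `(x 1)²`; the remaining ones are the
    -- factors of the odd case.
    rw [List.range_succ_eq_map, List.map_cons, List.prod_cons, List.map_map,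
      show 2 * (n + 1) = 2 * n + 1 + 1 by ring, divSum_neg_one_succ hx, ← ih, ← mul_assoc, ← sq]
    simp [divFactor, qInt, Function.comp_def, mul_add]
  induction n with
  | zero =>
    have h00 : divSum k x K (-1) 0 = 1 := by
      simp [divSum, h0, divCoeff_zero_right]
    refine ⟨by simp [h00], ?_⟩
    rw [mul_zero, zero_add, divSum_one_succ hx 0, h00]
    simp [qInt]
  | succ n ih =>
    refine ⟨hstep n ih.2, ?_⟩
    rw [show 2 * (n + 1) + 1 = 2 * n + 1 + 1 + 1 by ring, divSum_one_succ hx,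
      divSum_neg_one_succ hx, show 2 * n + 1 + 1 - 1 = 2 * n + 1 by omega, ← ih.2,
      prod_divFactor_succ hK (fun j => 2 * j + 2), mul_add, mul_smul_comm, ← mul_assoc (x 1) _ K]

/-- The parity `1̄` for even `n`. Two steps of the recursions, through `D_{-1}(2n+1) = x 1 *
D_1(2n)`, add exactly the factor with `[2n+1]`. -/
theorem prod_eq_divSum_odd (hx : ∀ n : ℕ, x 1 * x n = v k ^ (-(n : ℤ)) • x (n + 1) +
      (v k ^ (n : ℤ) - v k ^ (-(n : ℤ))) • (x (n - 1) * K)) (h0 : x 0 = 1)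
    (hK : Commute (x 1) K) (n : ℕ) :
    ((List.range n).map fun j => divFactor k (x 1) K (2 * j + 1)).prod =
      divSum k x K 1 (2 * n) := by
  induction n with
  | zero => simp [divSum, h0, divCoeff_zero_right]
  | succ n ih =>
    rw [prod_divFactor_succ hK (fun j => 2 * j + 1), ih, show 2 * (n + 1) = 2 * n + 1 + 1 by ring,
      divSum_one_succ hx, divSum_neg_one_succ hx, Nat.add_sub_cancel]

theorem inv_smul_divSum (x : ℕ → A) (K : A) (σ : ℤ) (n : ℕ) :
    (qFact k n)⁻¹ • divSum k x K σ n = ∑ j ∈ Finset.range (n / 2 + 1),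
      (v k ^ ((j : ℤ) * ((j : ℤ) + σ) - ((n - 2 * j).choose 2 : ℕ)) *
        (v k - (v k)⁻¹) ^ j / (qFact k (n - 2 * j) * qDoubleFact k j)) •
        (x (n - 2 * j) * K ^ j) := by
  rw [divSum, Finset.smul_sum]
  refine Finset.sum_congr rfl fun j hj => ?_
  rw [Finset.mem_range] at hj
  rw [smul_smul, divCoeff, if_pos (by omega), inv_mul_cancel_left₀ (qFact_ne_zero n)]

end Recursion

/-! ### Modules killed by `ε`, which are vector spaces over `k` -/

section EpsTrivial

open Abelian DualNumber

variable {k : Type u} [Field k] {X Y : Type u} [AddCommGroup X] [Module k[ε] X]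
  [AddCommGroup Y] [Module k[ε] Y]

theorem smul_eq_fst_smul [Module k X] [IsScalarTower k k[ε] X]
    (hX : ∀ x : X, (ε : k[ε]) • x = 0) (r : k[ε]) (x : X) :
    r • x = TrivSqZeroExt.fst r • x := by
  have h : r = algebraMap k k[ε] (TrivSqZeroExt.fst r) +
      algebraMap k k[ε] (TrivSqZeroExt.snd r) * ε := by
    ext <;> simp [TrivSqZeroExt.algebraMap_eq_inl]
  conv_lhs => rw [h, add_smul, mul_smul, hX, smul_zero, add_zero, algebraMap_smul]

/-- A `k`-linear map between `k[ε]`-modules on which `ε` acts as zero is `k[ε]`-linear. -/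
def extendEps [Module k X] [IsScalarTower k k[ε] X] [Module k Y] [IsScalarTower k k[ε] Y]
    (hX : ∀ x : X, (ε : k[ε]) • x = 0) (hY : ∀ y : Y, (ε : k[ε]) • y = 0) (f : X →ₗ[k] Y) :
    X →ₗ[k[ε]] Y where
  toFun := f
  map_add' := map_add f
  map_smul' r x := by
    rw [smul_eq_fst_smul hX, map_smul, RingHom.id_apply, smul_eq_fst_smul hY]

/-- Both modules are `k`-vector spaces, and over a finite field the number of elements determines
the dimension. Isomorphisms are later obtained by counting in this way. -/
theorem exists_linearEquiv_of_card_eq [Finite k] [Finite X] [Finite Y]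
    (hX : ∀ x : X, (ε : k[ε]) • x = 0) (hY : ∀ y : Y, (ε : k[ε]) • y = 0)
    (h : Nat.card X = Nat.card Y) : Nonempty (X ≃ₗ[k[ε]] Y) := by
  let : Module k X := Module.compHom X (algebraMap k k[ε])
  have : IsScalarTower k k[ε] X := IsScalarTower.of_algebraMap_smul fun _ _ => rfl
  let : Module k Y := Module.compHom Y (algebraMap k k[ε])
  have : IsScalarTower k k[ε] Y := IsScalarTower.of_algebraMap_smul fun _ _ => rfl
  have : Module.Finite k X := Module.Finite.of_finite
  have : Module.Finite k Y := Module.Finite.of_finite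
  rw [Module.natCard_eq_pow_finrank (K := k), Module.natCard_eq_pow_finrank (K := k) (V := Y)] at h
  have e := LinearEquiv.ofFinrankEq X Y (Nat.pow_right_injective Finite.one_lt_card h)
  exact ⟨LinearEquiv.ofBijective (extendEps hX hY e.toLinearMap) e.bijective⟩

/-- `X` is a line over `k`, so `Hom(X, Y)` has the dimension of `Y`. -/
theorem card_linearMap_of_card_eq [Finite k] [Finite X] [Finite Y]
    (hX : ∀ x : X, (ε : k[ε]) • x = 0) (hY : ∀ y : Y, (ε : k[ε]) • y = 0)
    (h : Nat.card X = Nat.card k) : Nat.card (X →ₗ[k[ε]] Y) = Nat.card Y := by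
  let : Module k X := Module.compHom X (algebraMap k k[ε])
  have : IsScalarTower k k[ε] X := IsScalarTower.of_algebraMap_smul fun _ _ => rfl
  let : Module k Y := Module.compHom Y (algebraMap k k[ε])
  have : IsScalarTower k k[ε] Y := IsScalarTower.of_algebraMap_smul fun _ _ => rfl
  have : Module.Finite k X := Module.Finite.of_finite
  have : Module.Finite k Y := Module.Finite.of_finite
  have e : (X →ₗ[k[ε]] Y) ≃ (X →ₗ[k] Y) :=
    { toFun := fun f => f.restrictScalars k
      invFun := extendEps hX hY
      left_inv := fun _ => rfl
      right_inv := fun _ => rfl }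
  have h1 : Module.finrank k X = 1 := by
    rw [Module.natCard_eq_pow_finrank (K := k)] at h
    exact Nat.pow_right_injective (Finite.one_lt_card (α := k)) (h.trans (pow_one _).symm)
  rw [Nat.card_congr e, Module.natCard_eq_pow_finrank (K := k),
    Module.natCard_eq_pow_finrank (K := k) (V := Y), Module.finrank_linearMap, h1, one_mul]

theorem eps_smul_of_surjective (hX : ∀ x : X, (ε : k[ε]) • x = 0) (g : X →ₗ[k[ε]] Y)
    (hg : Function.Surjective g) (y : Y) : (ε : k[ε]) • y = 0 := by
  obtain ⟨x, rfl⟩ := hg y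
  rw [← map_smul, hX, map_zero]

theorem exists_section (hX : ∀ x : X, (ε : k[ε]) • x = 0) (g : X →ₗ[k[ε]] Y)
    (hg : Function.Surjective g) : ∃ s : Y →ₗ[k[ε]] X, ∀ y, g (s y) = y := by
  let : Module k X := Module.compHom X (algebraMap k k[ε])
  have : IsScalarTower k k[ε] X := IsScalarTower.of_algebraMap_smul fun _ _ => rfl
  let : Module k Y := Module.compHom Y (algebraMap k k[ε])
  have : IsScalarTower k k[ε] Y := IsScalarTower.of_algebraMap_smul fun _ _ => rfl
  obtain ⟨s, hs⟩ := (g.restrictScalars k).exists_rightInverse_of_surjective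
    (LinearMap.range_eq_top.2 hg)
  exact ⟨extendEps (eps_smul_of_surjective hX g hg) hX s, fun y => LinearMap.congr_fun hs y⟩

theorem exists_retraction (hY : ∀ y : Y, (ε : k[ε]) • y = 0) (f : X →ₗ[k[ε]] Y)
    (hf : Function.Injective f) : ∃ r : Y →ₗ[k[ε]] X, ∀ x, r (f x) = x := by
  let : Module k X := Module.compHom X (algebraMap k k[ε])
  have : IsScalarTower k k[ε] X := IsScalarTower.of_algebraMap_smul fun _ _ => rfl
  let : Module k Y := Module.compHom Y (algebraMap k k[ε])
  have : IsScalarTower k k[ε] Y := IsScalarTower.of_algebraMap_smul fun _ _ => rfl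
  obtain ⟨s, hs⟩ := (f.restrictScalars k).exists_leftInverse_of_injective
    (LinearMap.ker_eq_bot.2 hf)
  have hX : ∀ x : X, (ε : k[ε]) • x = 0 := fun x => hf (by rw [map_smul, hY, map_zero])
  exact ⟨extendEps hY hX s, fun y => LinearMap.congr_fun hs y⟩

theorem exists_smul_eq_of_card [Finite k] [Finite X] (h : Nat.card X = Nat.card k) {x : X}
    (hx : x ≠ 0) (y : X) : ∃ r : k[ε], r • x = y := by
  let : Module k X := Module.compHom X (algebraMap k k[ε])
  have : IsScalarTower k k[ε] X := IsScalarTower.of_algebraMap_smul fun _ _ => rfl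
  have : Module.Finite k X := Module.Finite.of_finite
  have h1 : Module.finrank k X = 1 := by
    rw [Module.natCard_eq_pow_finrank (K := k)] at h
    exact Nat.pow_right_injective (Finite.one_lt_card (α := k)) (h.trans (pow_one _).symm)
  obtain ⟨c, rfl⟩ := (finrank_eq_one_iff_of_nonzero' x hx).1 h1 y
  exact ⟨algebraMap k k[ε] c, rfl⟩

/-- A nonzero map out of a module with as many elements as `k` is injective. -/
theorem injective_of_ne_zero [Finite k] [Finite X] (h : Nat.card X = Nat.card k)
    (f : X →ₗ[k[ε]] Y) (hf : f ≠ 0) : Function.Injective f := by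
  rw [injective_iff_map_eq_zero]
  intro x hx
  by_contra hx0
  refine hf (LinearMap.ext fun y => ?_)
  obtain ⟨c, rfl⟩ := exists_smul_eq_of_card h hx0 y
  rw [map_smul, hx, smul_zero, LinearMap.zero_apply]

theorem isUnit_of_fst_ne_zero {r : k[ε]} (h : TrivSqZeroExt.fst r ≠ 0) : IsUnit r :=
  TrivSqZeroExt.isUnit_iff_isUnit_fst.2 (isUnit_iff_ne_zero.2 h)

theorem eq_eps_mul_of_fst_eq_zero {r : k[ε]} (h : TrivSqZeroExt.fst r = 0) :
    r = ε * TrivSqZeroExt.inl (TrivSqZeroExt.snd r) := by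
  ext <;> simp [h]

/-- The equivalence `Y ≃ X × P` given by a split injection `X → Y` and an identification of the
kernel of the retraction with `P`. -/
theorem exists_retraction_decomposition [Finite k] [Finite X] [Finite Y] {P : Type u}
    [AddCommGroup P] [Module k[ε] P] [Finite P] (f : X →ₗ[k[ε]] Y) (r : Y →ₗ[k[ε]] X)
    (hr : ∀ x, r (f x) = x) (hker : ∀ y, r y = 0 → (ε : k[ε]) • y = 0)
    (hP : ∀ p : P, (ε : k[ε]) • p = 0) (h : Nat.card Y = Nat.card X * Nat.card P) :
    ∃ e : Y ≃ₗ[k[ε]] X × P, ∀ y, (e y).1 = r y ∧ ((e y).2 = 0 ↔ y = f (r y)) := by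
  have hx : Nat.card Y = Nat.card X * Nat.card (LinearMap.ker r) :=
    card_of_exactPair (R := k[ε]) (L := Y) ⟨((LinearMap.ker r).subtype, r), Subtype.val_injective,
      fun x => ⟨f x, hr x⟩, LinearMap.exact_subtype_ker_map r⟩
  have hc : Nat.card (LinearMap.ker r) = Nat.card P :=
    Nat.eq_of_mul_eq_mul_left Nat.card_pos (hx.symm.trans h)
  obtain ⟨e⟩ := exists_linearEquiv_of_card_eq (X := LinearMap.ker r) (Y := P)
    (fun y => Subtype.ext (hker _ y.2)) hP hc
  -- The projection to the kernel of `r` along the image of `f`. Once `(r, e ∘ p)` is known to be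
  -- injective, equality of cardinalities makes it bijective.
  let p : Y →ₗ[k[ε]] LinearMap.ker r :=
    (LinearMap.id - f ∘ₗ r).codRestrict _ (fun y => by simp [hr])
  have hp : ∀ y, (p y : Y) = y - f (r y) := fun y => rfl
  have hp0 : ∀ y, e (p y) = 0 ↔ y = f (r y) := by
    intro y
    rw [map_eq_zero_iff e e.injective, Subtype.ext_iff, hp, ZeroMemClass.coe_zero, sub_eq_zero]
  have hinj : Function.Injective (r.prod (e.toLinearMap ∘ₗ p)) := by
    rw [injective_iff_map_eq_zero]
    intro y hy
    have h1 : r y = 0 := congrArg Prod.fst hy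
    have h2 : e (p y) = 0 := congrArg Prod.snd hy
    rw [(hp0 y).1 h2, h1, map_zero]
  refine ⟨LinearEquiv.ofBijective _
    (hinj.bijective_of_nat_card_le (by rw [Nat.card_prod, h])), fun y => ⟨rfl, hp0 y⟩⟩

/-- The quotient map `k[ε] → k[ε]/(ε)` and multiplication by `ε` give a short exact sequence
`0 → S → k[ε] → S → 0`. -/
theorem nonempty_exactPair_simple : Nonempty (ExactPair k[ε] (k[ε] ⧸ Ideal.span {(ε : k[ε])})
    (k[ε] ⧸ Ideal.span {(ε : k[ε])}) k[ε]) := by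
  have hmem : ∀ r : k[ε], r ∈ Ideal.span {(ε : k[ε])} ↔ TrivSqZeroExt.fst r = 0 := by
    intro r
    rw [Ideal.mem_span_singleton]
    constructor
    · rintro ⟨c, rfl⟩; simp
    · intro h
      refine ⟨TrivSqZeroExt.inl (TrivSqZeroExt.snd r), ?_⟩
      ext <;> simp [h]
  have hker : ∀ r : k[ε], (ε : k[ε]) * r = 0 ↔ r ∈ Ideal.span {(ε : k[ε])} := by
    intro r
    rw [hmem]
    constructor
    · intro h; simpa using congrArg TrivSqZeroExt.snd h
    · intro h; ext <;> simp [h]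
  let i : (k[ε] ⧸ Ideal.span {(ε : k[ε])}) →ₗ[k[ε]] k[ε] :=
    Submodule.liftQ _ (LinearMap.mulLeft k[ε] (ε : k[ε])) (fun r hr => (hker r).2 hr)
  refine ⟨⟨(i, Submodule.mkQ _), ?_, Submodule.mkQ_surjective _, ?_⟩⟩
  · rw [injective_iff_map_eq_zero]
    intro x hx
    obtain ⟨r, rfl⟩ := Submodule.Quotient.mk_surjective _ x
    exact (Submodule.Quotient.mk_eq_zero _).2 ((hker r).1 hx)
  · intro r
    refine (Submodule.Quotient.mk_eq_zero _).trans ?_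
    constructor
    · intro hr
      obtain ⟨c, rfl⟩ := Ideal.mem_span_singleton.1 hr
      exact ⟨Submodule.Quotient.mk c, rfl⟩
    · rintro ⟨x, rfl⟩
      obtain ⟨c, rfl⟩ := Submodule.Quotient.mk_surjective _ x
      exact Ideal.mem_span_singleton.2 ⟨c, rfl⟩

omit [Field k] in
theorem card_dualNumber [Finite k] : Nat.card k[ε] = Nat.card k ^ 2 := by
  rw [sq, ← Nat.card_prod]; rfl

/-- The exact sequence `0 → S → k[ε] → S → 0` gives `q² = |S|²`. -/
theorem card_simple [Finite k] : Nat.card (k[ε] ⧸ Ideal.span {(ε : k[ε])}) = Nat.card k := by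
  have : Finite k[ε] := inferInstanceAs (Finite (k × k))
  obtain ⟨x⟩ := nonempty_exactPair_simple (k := k)
  have h := card_of_exactPair x
  rw [card_dualNumber, ← sq] at h
  exact (Nat.pow_left_injective two_ne_zero h).symm

theorem eps_smul_simple (x : k[ε] ⧸ Ideal.span {(ε : k[ε])}) : (ε : k[ε]) • x = 0 := by
  obtain ⟨r, rfl⟩ := Submodule.Quotient.mk_surjective _ x
  exact (Submodule.Quotient.mk_eq_zero _).2 (Ideal.mem_span_singleton.2 ⟨r, rfl⟩)

end EpsTrivial

/-! ### Split sequences and the zero class -/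

section Middle

open Abelian DualNumber

variable {R : Type u} [CommRing R] {M N L : ModuleCat.{u} R}

/-- The pullback of the class along `g : L → M` vanishes; pulling back further along `s` returns the
class itself, as `g ∘ s` is the identity. -/
theorem ExactPair.cls_eq_zero_of_section (x : ExactPair R M N L) (s : M →ₗ[R] L)
    (hs : ∀ m, x.1.2 (s m) = m) : x.cls = 0 := by
  have h : ModuleCat.ofHom s ≫ x.complex.g = 𝟙 M := by ext m; exact hs m
  have := congrArg (fun e => (Ext.mk₀ (ModuleCat.ofHom s)).comp e (zero_add 1))
    x.shortExact.comp_extClass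
  simp only [Ext.comp_zero] at this
  rw [← Ext.comp_assoc_of_second_deg_zero, Ext.mk₀_comp_mk₀, h, Ext.mk₀_id_comp] at this
  exact this

/-- In the long exact sequence of `Hom(M, -)` the class is the image of the identity of `M`; when it
is zero, the identity lifts to `L`. -/
theorem ExactPair.exists_section_of_cls_eq_zero (x : ExactPair R M N L) (h : x.cls = 0) :
    ∃ s : M →ₗ[R] L, ∀ m, x.1.2 (s m) = m := by
  obtain ⟨s, hs⟩ := Ext.covariant_sequence_exact₃ M x.shortExact (Ext.mk₀ (𝟙 M)) (zero_add 1)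
    (by rw [show x.shortExact.extClass = 0 from h, Ext.comp_zero])
  obtain ⟨s, rfl⟩ := Ext.homEquiv₀.symm.surjective s
  have hs' : s ≫ x.complex.g = 𝟙 M := by
    apply Ext.homEquiv₀.symm.injective
    simpa using hs
  exact ⟨s.hom, fun m => LinearMap.congr_fun (congrArg ModuleCat.Hom.hom hs') m⟩

/-- A morphism of short exact sequences which is the identity on the right expresses one class as a
pushout of the other. -/
theorem ExactPair.cls_comp {N' L' : ModuleCat.{u} R} (x : ExactPair R M N L)
    (y : ExactPair R M N' L') (a : N ⟶ N') (φ : L →ₗ[R] L')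
    (h1 : ∀ n, φ (x.1.1 n) = y.1.1 (a.hom n)) (h2 : ∀ l, y.1.2 (φ l) = x.1.2 l) :
    x.cls.comp (Ext.mk₀ a) (add_zero 1) = y.cls := by
  let F : x.complex ⟶ y.complex :=
    { τ₁ := a
      τ₂ := ModuleCat.ofHom φ
      τ₃ := 𝟙 M
      comm₁₂ := by ext n; exact (h1 n).symm
      comm₂₃ := by ext l; exact h2 l }
  have := ShortComplex.ShortExact.extClass_naturality x.shortExact y.shortExact F
  simpa [F, ExactPair.cls] using this

end Middle

/-! ### Extensions of a simple module by a module killed by `ε` -/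

section ExtSimple

open Abelian DualNumber

variable {k : Type u} [Field k] [Finite k]

omit [Field k] in
instance : Finite k[ε] := inferInstanceAs (Finite (k × k))

instance : Finite (k[ε] ⧸ Ideal.span {(ε : k[ε])}) :=
  Finite.of_surjective _ (Submodule.mkQ_surjective _)

theorem nonempty_exactPair_of_card {S : Type u} [AddCommGroup S] [Module k[ε] S] [Finite S]
    (hS : ∀ s : S, (ε : k[ε]) • s = 0) (hc : Nat.card S = Nat.card k) :
    Nonempty (ExactPair k[ε] S S k[ε]) := by
  have := nonempty_exactPair_simple (k := k)
  obtain ⟨e⟩ := exists_linearEquiv_of_card_eq (X := k[ε] ⧸ Ideal.span {(ε : k[ε])}) (Y := S)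
    eps_smul_simple hS (card_simple.trans hc.symm)
  have h := card_exactPair_congr e e (LinearEquiv.refl k[ε] k[ε])
  have : Nat.card (ExactPair k[ε] S S k[ε]) ≠ 0 := by
    rw [← h]
    exact Nat.card_pos.ne'
  exact (Nat.card_ne_zero.1 this).1

variable {S N : ModuleCat.{u} k[ε]} [Finite S] [Finite N]

omit [Finite N] in
/-- For a simple module `S`, every class in `Ext¹(S, N)` is the pushout of a unique map `S → N`. -/
theorem bijective_cls_comp (hc : Nat.card S = Nat.card k)
    (hN : ∀ y : N, (ε : k[ε]) • y = 0) (x : ExactPair k[ε] S S (ModuleCat.of k[ε] k[ε])) :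
    Function.Bijective fun f : S ⟶ N => x.cls.comp (Ext.mk₀ f) (add_zero 1) := by
  have : Nontrivial S := Finite.one_lt_card_iff_nontrivial.1 (hc ▸ Finite.one_lt_card)
  constructor
  -- If the pushout along `f` splits, then `f` extends along `S → k[ε]` to a map `a` on `k[ε]`. The
  -- image of `S` lies in `(ε)`, and `a` sends `(ε)` to `ε N = 0`.
  · have key : ∀ f : S ⟶ N, x.cls.comp (Ext.mk₀ f) (add_zero 1) = 0 → f = 0 := by
      intro f hf
      obtain ⟨a, ha⟩ := Ext.contravariant_sequence_exact₁ x.shortExact N (Ext.mk₀ f) (add_zero 1) hf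
      obtain ⟨a, rfl⟩ := Ext.homEquiv₀.symm.surjective a
      have ha' : x.complex.f ≫ a = f := by
        apply Ext.homEquiv₀.symm.injective
        simpa using ha
      ext s
      have hs : f.hom s = a.hom (x.1.1 s) := by rw [← ha']; rfl
      have h0 : x.1.2 (x.1.1 s) = 0 := (x.2.2.2 _).2 ⟨s, rfl⟩
      rw [hs]
      let r : k[ε] := x.1.1 s
      change a.hom r = 0
      have hr : TrivSqZeroExt.fst r = 0 := by
        -- Otherwise `r` is a unit in the image of `S`, hence in the kernel of the surjection `k[ε]
        -- → S`, which would then be zero.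
        by_contra hr
        obtain ⟨t, ht⟩ := (isUnit_of_fst_ne_zero hr).exists_left_inv
        obtain ⟨y, hy⟩ := exists_ne (0 : S)
        obtain ⟨z, rfl⟩ := x.2.2.1 y
        refine hy ?_
        let z' : k[ε] := z
        have h2 : z' = (z' * t) • r := by rw [smul_eq_mul, mul_assoc, ht, mul_one]
        change x.1.2 z' = 0
        rw [h2]
        exact (map_smul x.1.2 (z' * t) _).trans (by rw [h0, smul_zero])
      rw [eq_eps_mul_of_fst_eq_zero hr, ← smul_eq_mul]
      exact (map_smul a.hom (ε : k[ε]) _).trans (hN _)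
    intro f g hfg
    refine sub_eq_zero.1 (key _ ?_)
    dsimp only at hfg
    rw [sub_eq_add_neg, Ext.mk₀_add, Ext.comp_add, hfg, Ext.mk₀_neg, Ext.comp_neg, add_neg_cancel]
  · intro e
    -- `Ext¹(k[ε], N) = 0`, so in the long exact sequence every class in `Ext¹(S, N)` comes from
    -- `Hom(S, N)`.
    have : Projective (ModuleCat.of k[ε] k[ε]) :=
      (IsProjective.iff_projective (R := k[ε]) (P := k[ε])).1 inferInstance
    obtain ⟨f, hf⟩ := Ext.contravariant_sequence_exact₃ x.shortExact N e
      (Ext.eq_zero_of_projective (P := ModuleCat.of k[ε] k[ε]) _) (add_zero 1)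
    obtain ⟨f, rfl⟩ := Ext.homEquiv₀.symm.surjective f
    exact ⟨f, hf⟩

theorem card_ext_one (hS : ∀ s : S, (ε : k[ε]) • s = 0) (hc : Nat.card S = Nat.card k)
    (hN : ∀ y : N, (ε : k[ε]) • y = 0) : Nat.card (Ext.{u} S N 1) = Nat.card N := by
  obtain ⟨x⟩ := nonempty_exactPair_of_card hS hc
  rw [← card_linearMap_of_card_eq hS hN hc, ← Nat.card_congr (ModuleCat.homEquiv (M := S) (N := N))]
  exact (Nat.card_congr (Equiv.ofBijective _
    (bijective_cls_comp (S := S) hc hN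
      (show ExactPair k[ε] S S (ModuleCat.of k[ε] k[ε]) from x)))).symm

omit [Finite k] [Finite S] [Finite N] in
-- If the sequence splits, `L` is the sum of copies of `N` and `S`, both killed by `ε`; conversely,
-- a surjection out of a module killed by `ε` has a section.
theorem zero_mem_extMiddle_iff {L : ModuleCat.{u} k[ε]}
    (hS : ∀ s : S, (ε : k[ε]) • s = 0) (hN : ∀ y : N, (ε : k[ε]) • y = 0)
    (x : ExactPair k[ε] S N L) :
    (0 : Ext.{u} S N 1) ∈ extMiddle S N L ↔ ∀ l : L, (ε : k[ε]) • l = 0 := by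
  rw [mem_extMiddle_iff]
  constructor
  · rintro ⟨y, hy⟩ l
    obtain ⟨s, hs⟩ := y.exists_section_of_cls_eq_zero hy
    obtain ⟨n, hn⟩ := (y.2.2.2 (l - s (y.1.2 l))).1 (by rw [map_sub, hs, sub_self])
    rw [← sub_add_cancel l (s (y.1.2 l)), ← hn, smul_add, ← map_smul, ← map_smul, hS,
      hN, map_zero, map_zero, add_zero]
  · intro h
    obtain ⟨s, hs⟩ := exists_section h x.1.2 x.2.2.1
    exact ⟨x, x.cls_eq_zero_of_section s hs⟩

omit [Finite k] [Finite S] [Finite N] in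
theorem card_extMiddle_of_eps_trivial {L : ModuleCat.{u} k[ε]}
    (hL : ∀ l : L, (ε : k[ε]) • l = 0) (x : ExactPair k[ε] S N L) :
    Nat.card (extMiddle S N L) = 1 := by
  have h : ∀ y : ExactPair k[ε] S N L, y.cls = 0 := fun y => by
    obtain ⟨s, hs⟩ := exists_section hL y.1.2 y.2.2.1
    exact y.cls_eq_zero_of_section s hs
  have : extMiddle S N L = {0} := by
    ext e
    rw [mem_extMiddle_iff, Set.mem_singleton_iff]
    exact ⟨fun ⟨y, hy⟩ => hy ▸ h y, fun he => ⟨x, he ▸ h x⟩⟩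
  rw [this]
  simp

variable {P : Type u} [AddCommGroup P] [Module k[ε] P] [Finite P]

/-- Every nonzero class in `Ext¹(S, N)` has the middle term `k[ε] × P`, where `P` is such that
`N` has as many elements as `S × P`. -/
theorem extMiddle_prod (hS : ∀ s : S, (ε : k[ε]) • s = 0) (hc : Nat.card S = Nat.card k)
    (hN : ∀ y : N, (ε : k[ε]) • y = 0) (hP : ∀ p : P, (ε : k[ε]) • p = 0)
    (h : Nat.card N = Nat.card k * Nat.card P) :
    extMiddle S N (ModuleCat.of k[ε] (k[ε] × P)) = {0}ᶜ := by
  ext e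
  rw [Set.mem_compl_singleton_iff]
  constructor
  · rintro he rfl
    obtain ⟨x, -⟩ := (mem_extMiddle_iff _).1 he
    have := (zero_mem_extMiddle_iff hS hN x).1 he ((1, 0) : k[ε] × P)
    have h1 : (ε : k[ε]) • (1 : k[ε]) = 0 := congrArg Prod.fst this
    simpa using congrArg TrivSqZeroExt.snd h1
  · intro he
    obtain ⟨x⟩ := nonempty_exactPair_of_card hS hc
    obtain ⟨f, rfl⟩ := (bijective_cls_comp (S := S) hc hN
      (show ExactPair k[ε] S S (ModuleCat.of k[ε] k[ε]) from x)).2 e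
    have hf : f.hom ≠ 0 := by
      intro hf
      apply he
      have : f = 0 := ModuleCat.hom_ext hf
      simp [this]
    -- The nonzero map `f` splits, which identifies `N` with `S × P` and `f` with the inclusion of
    -- `S`. The pushout of `S → k[ε]` along `f` is then `k[ε] × P`.
    obtain ⟨r, hr⟩ := exists_retraction hN f.hom (injective_of_ne_zero hc f.hom hf)
    obtain ⟨E, hE⟩ := exists_retraction_decomposition f.hom r hr (fun y _ => hN y) hP
      (by rw [hc, h])
    have hE' : ∀ s, E (f.hom s) = (s, 0) := fun s =>
      Prod.ext ((hE _).1.trans (hr s)) ((hE _).2.2 (by rw [hr]))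
    rw [mem_extMiddle_iff]
    refine ⟨⟨((x.1.1.prodMap LinearMap.id) ∘ₗ E.toLinearMap, x.1.2 ∘ₗ LinearMap.fst k[ε] k[ε] P),
      ?_, ?_, ?_⟩, ?_⟩
    · exact (Function.Injective.prodMap x.2.1 Function.injective_id).comp E.injective
    · exact x.2.2.1.comp Prod.fst_surjective
    · rintro ⟨c, p⟩
      refine (x.2.2.2 c).trans ?_
      constructor
      · rintro ⟨s, rfl⟩
        exact ⟨E.symm (s, p), by simp⟩
      · rintro ⟨y, hy⟩
        exact ⟨(E y).1, congrArg Prod.fst hy⟩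
    · symm
      refine ExactPair.cls_comp (L := ModuleCat.of k[ε] k[ε]) _ _ f (LinearMap.inl k[ε] k[ε] P)
        (fun s => ?_) (fun _ => rfl)
      change (x.1.1 s, (0 : P)) = (x.1.1.prodMap LinearMap.id) (E (f.hom s))
      rw [hE']
      rfl

/-- All of the `|N|` classes except the zero class. -/
theorem card_extMiddle_prod (hS : ∀ s : S, (ε : k[ε]) • s = 0) (hc : Nat.card S = Nat.card k)
    (hN : ∀ y : N, (ε : k[ε]) • y = 0) (hP : ∀ p : P, (ε : k[ε]) • p = 0)
    (h : Nat.card N = Nat.card k * Nat.card P) :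
    Nat.card (extMiddle S N (ModuleCat.of k[ε] (k[ε] × P))) + 1 = Nat.card N := by
  have hcard := card_ext_one hS hc hN
  have : Finite (Ext.{u} S N 1) := Nat.finite_of_card_ne_zero (hcard ▸ Nat.card_pos.ne')
  rw [extMiddle_prod hS hc hN hP h, ← hcard, Nat.card_coe_set_eq,
    ← Set.ncard_add_ncard_compl {(0 : Ext.{u} S N 1)}, Set.ncard_singleton, add_comm]

omit [Finite k] in
-- Self-injectivity of `k[ε]`, read off from the free module of rank one.
theorem exists_retraction_dualNumber {L : Type u} [AddCommGroup L] [Module k[ε] L]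
    (j : k[ε] →ₗ[k[ε]] L) (hj : Function.Injective j) :
    ∃ r : L →ₗ[k[ε]] k[ε], ∀ c, r (j c) = c := by
  let e := LinearEquiv.funUnique (Fin 1) k[ε] k[ε]
  obtain ⟨r, hr⟩ := (injective_free (k := k) (Fin 1)).out (j ∘ₗ e.toLinearMap)
    (hj.comp e.injective) LinearMap.id
  refine ⟨e.toLinearMap ∘ₗ r, fun c => ?_⟩
  have := hr (e.symm c)
  simp only [LinearMap.comp_apply, LinearEquiv.coe_coe, LinearEquiv.apply_symm_apply,
    LinearMap.id_apply] at this
  simp [this]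

omit [Finite N] in
/-- If `ε` acts nontrivially on the middle term, then this is isomorphic to `k[ε] × P`. -/
theorem nonempty_linearEquiv_prod {L : ModuleCat.{u} k[ε]} [Finite L]
    (hc : Nat.card S = Nat.card k) (hN : ∀ y : N, (ε : k[ε]) • y = 0)
    (hP : ∀ p : P, (ε : k[ε]) • p = 0) (h : Nat.card N = Nat.card k * Nat.card P)
    (x : ExactPair k[ε] S N L) {l : L} (hl : (ε : k[ε]) • l ≠ 0) :
    Nonempty (L ≃ₗ[k[ε]] k[ε] × P) := by
  have hgl : x.1.2 l ≠ 0 := by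
    intro h0
    obtain ⟨n, rfl⟩ := (x.2.2.2 l).1 h0
    exact hl (by rw [← map_smul, hN, map_zero])
  -- As `ε l ≠ 0`, the element `l` spans a free submodule: a nonzero `r` is a unit or `ε` times a
  -- unit, and neither kills `l`. By self-injectivity this submodule splits off.
  have hj : Function.Injective (LinearMap.toSpanSingleton k[ε] L l) := by
    rw [injective_iff_map_eq_zero]
    intro r hr
    rw [LinearMap.toSpanSingleton_apply] at hr
    have hr0 : TrivSqZeroExt.fst r = 0 := by
      by_contra h0
      obtain ⟨t, ht⟩ := (isUnit_of_fst_ne_zero h0).exists_left_inv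
      apply hl
      rw [← one_smul k[ε] l, ← ht, mul_smul, hr, smul_zero, smul_zero]
    have hr1 := eq_eps_mul_of_fst_eq_zero hr0
    by_contra hne
    have hs : TrivSqZeroExt.fst (TrivSqZeroExt.inl (TrivSqZeroExt.snd r) : k[ε]) ≠ 0 := by
      intro h0
      rw [TrivSqZeroExt.fst_inl] at h0
      exact hne (TrivSqZeroExt.ext hr0 h0)
    obtain ⟨t, ht⟩ := (isUnit_of_fst_ne_zero hs).exists_left_inv
    apply hl
    rw [hr1, mul_comm, mul_smul] at hr
    rw [← one_smul k[ε] ((ε : k[ε]) • l), ← ht, mul_smul, hr, smul_zero]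
  obtain ⟨r, hr⟩ := exists_retraction_dualNumber _ hj
  have hcard : Nat.card L = Nat.card k[ε] * Nat.card P := by
    rw [card_of_exactPair x, hc, h, card_dualNumber, sq, mul_assoc]
  obtain ⟨E, -⟩ := exists_retraction_decomposition (P := P) (LinearMap.toSpanSingleton k[ε] L l) r hr
    -- The complement, the kernel of `r`, is killed by `ε`. The image of `l` generates `S`, so `y -
    -- c l` lies in `N` for some `c`, and `ε y = (ε c) l`. Applying `r` gives `ε c = 0`.
    (fun y hy => by
      obtain ⟨c, hc'⟩ := exists_smul_eq_of_card hc hgl (x.1.2 y)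
      obtain ⟨n, hn⟩ := (x.2.2.2 (y - c • l)).1 (by rw [map_sub, map_smul, hc', sub_self])
      have h1 : (ε : k[ε]) • y = LinearMap.toSpanSingleton k[ε] L l (ε * c) := by
        rw [LinearMap.toSpanSingleton_apply, mul_smul, ← sub_eq_zero, ← smul_sub, ← hn, ← map_smul,
          hN, map_zero]
      have h2 : ε * c = 0 := by rw [← hr (ε * c), ← h1, map_smul, hy, smul_zero]
      rw [h1, h2, map_zero]) hP hcard
  exact ⟨E⟩

end ExtSimple

/-! ### The products in the Hall algebra and their images in the `ı`Hall algebra -/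

section Products

open Abelian DualNumber

variable {k : Type u} [Field k] [Finite k]

omit [Finite k] in
theorem eps_smul_nS (n : ℕ) (y : (nS k n).obj) : (ε : k[ε]) • y = 0 := by
  funext i
  exact eps_smul_simple (k := k) _

theorem card_nS (n : ℕ) : Nat.card (nS k n).obj = Nat.card k ^ n := by
  refine (Nat.card_fun (α := Fin n) (β := k[ε] ⧸ Ideal.span {(ε : k[ε])})).trans ?_
  rw [card_simple, Nat.card_fin]

theorem resDim_nS (n : ℕ) : resDim (nS k n) = n :=
  Nat.pow_right_injective (Finite.one_lt_card (α := k))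
    ((card_eq_pow_resDim _).symm.trans (card_nS n))

theorem resDim_bbK : resDim (bbK k) = 2 :=
  Nat.pow_right_injective (Finite.one_lt_card (α := k))
    ((card_eq_pow_resDim _).symm.trans card_dualNumber)

theorem structConst_eq_zero {M N L : FGModuleCat.{u} k[ε]}
    (h : IsEmpty (ExactPair k[ε] M.obj N.obj L.obj)) : structConst M N L = 0 := by
  rw [structConst_eq, Nat.card_of_isEmpty]
  simp

omit [Field k] [Finite k] in
theorem v_zpow_two_mul (n : ℤ) : v k ^ (2 * n) = (Nat.card k : QV k) ^ n := by
  rw [zpow_mul, ← v_sq]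
  rfl

open Classical in
-- Every extension of the projective `𝕂` splits, and `Hom(𝕂, M) ≅ M` has `q ^ dim M` elements, which
-- cancels the twist `v ^ (2 dim M)`.
theorem structConst_bbK (M L : FGModuleCat.{u} k[ε]) :
    structConst (bbK k) M L =
      if (⟦FGModuleCat.of k[ε] (k[ε] × M.obj)⟧ : IsoClass k) = ⟦L⟧ then 1 else 0 := by
  have : Projective (bbK k).obj :=
    (IsProjective.iff_projective (R := k[ε]) (P := k[ε])).1 inferInstance
  have : Subsingleton (Ext.{u} (bbK k).obj M.obj 1) := Ext.subsingleton_of_projective _ _ _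
  split_ifs with h
  · obtain ⟨e⟩ := (mk_eq_mk_iff _ _).1 h
    have e' : (k[ε] × M.obj) ≃ₗ[k[ε]] L.obj := e
    have x : ExactPair k[ε] (bbK k).obj M.obj L.obj :=
      ⟨(e'.toLinearMap ∘ₗ LinearMap.inr k[ε] k[ε] M.obj,
        LinearMap.fst k[ε] k[ε] M.obj ∘ₗ e'.symm.toLinearMap),
        e'.injective.comp LinearMap.inr_injective,
        Prod.fst_surjective.comp e'.symm.surjective, fun l => by
          obtain ⟨⟨c, m⟩, rfl⟩ := e'.surjective l
          change (e'.symm (e' (c, m))).1 = 0 ↔ ∃ y, e' (0, y) = e' (c, m)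
          simp [eq_comm]⟩
    have hone : Nat.card (extMiddle (bbK k).obj M.obj L.obj) = 1 := by
      have : Nonempty (extMiddle (bbK k).obj M.obj L.obj) :=
        ⟨⟨_, (mem_extMiddle_iff _).2 ⟨x, rfl⟩⟩⟩
      obtain ⟨_⟩ := nonempty_unique (extMiddle (bbK k).obj M.obj L.obj)
      exact Nat.card_unique
    have hhom : Nat.card ((bbK k).obj ⟶ M.obj) = Nat.card k ^ resDim M := by
      rw [← card_eq_pow_resDim]
      exact (Nat.card_congr (ModuleCat.homEquiv (M := (bbK k).obj) (N := M.obj))).trans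
        (Nat.card_congr (LinearMap.ringLmapEquivSelf k[ε] ℕ M.obj).toEquiv)
    have hq : (Nat.card k : QV k) ≠ 0 := Nat.cast_ne_zero.2 Nat.card_pos.ne'
    rw [structConst, hone, hhom, eulerForm, resDim_bbK, Nat.cast_two, v_zpow_two_mul, zpow_natCast,
      Nat.cast_pow, Nat.cast_one, mul_one_div, div_self (pow_ne_zero _ hq)]
  · refine structConst_eq_zero ⟨fun x => h ((mk_eq_mk_iff _ _).2 ?_)⟩
    have : Module.Projective k[ε] (bbK k).obj := inferInstanceAs (Module.Projective k[ε] k[ε])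
    obtain ⟨s, hs⟩ := Module.projective_lifting_property x.1.2 LinearMap.id x.2.2.1
    have hs' : ∀ c, x.1.2 (s c) = c := fun c => LinearMap.congr_fun hs c
    have h0 : ∀ m, x.1.2 (x.1.1 m) = 0 := fun m => (x.2.2.2 _).2 ⟨m, rfl⟩
    have hb : Function.Bijective (LinearMap.coprod s x.1.1) := by
      constructor
      · rw [injective_iff_map_eq_zero]
        rintro ⟨c, m⟩ hcm
        rw [LinearMap.coprod_apply] at hcm
        have hc : c = 0 := by
          have := congrArg x.1.2 hcm
          rwa [map_add, hs', h0, add_zero, map_zero] at this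
        subst hc
        rw [map_zero, zero_add, map_eq_zero_iff _ x.2.1] at hcm
        exact Prod.ext rfl hcm
      · intro l
        obtain ⟨m, hm⟩ := (x.2.2.2 (l - s (x.1.2 l))).1 (by rw [map_sub, hs', sub_self])
        exact ⟨(x.1.2 l, m), by rw [LinearMap.coprod_apply, hm, add_sub_cancel]⟩
    exact ⟨LinearEquiv.ofBijective _ hb⟩

open Classical in
-- The middle terms are told apart by whether `ε` kills `L`: only the zero class has such a middle
-- term, and the `q ^ n - 1` nonzero classes share the other one. For `n = 0` the truncated `n - 1`
-- carries the coefficient `v ^ 0 - v ^ 0`.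
theorem structConst_nS (n : ℕ) (L : FGModuleCat.{u} k[ε]) :
    structConst (nS k 1) (nS k n) L =
      v k ^ (-(n : ℤ)) * (if (⟦nS k (n + 1)⟧ : IsoClass k) = ⟦L⟧ then 1 else 0) +
      (v k ^ (n : ℤ) - v k ^ (-(n : ℤ))) *
        (if (⟦FGModuleCat.of k[ε] (k[ε] × (nS k (n - 1)).obj)⟧ : IsoClass k) = ⟦L⟧ then 1 else 0) := by
  have hv : v k ≠ 0 := v_ne_zero
  have hc : Nat.card (nS k 1).obj = Nat.card k := (card_nS 1).trans (pow_one _)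
  have hS := eps_smul_nS (k := k) 1
  have hN := eps_smul_nS (k := k) n
  have hP := eps_smul_nS (k := k) (n - 1)
  have hhom : Nat.card ((nS k 1).obj ⟶ (nS k n).obj) = Nat.card k ^ n := by
    rw [Nat.card_congr (ModuleCat.homEquiv (M := (nS k 1).obj) (N := (nS k n).obj)),
      card_linearMap_of_card_eq hS hN hc, card_nS]
  have hconst : ∀ L, structConst (nS k 1) (nS k n) L = v k ^ (-(n : ℤ)) *
      Nat.card (extMiddle (nS k 1).obj (nS k n).obj L.obj) := by
    intro L
    rw [structConst, hhom, eulerForm, resDim_nS, resDim_nS, Nat.cast_pow, ← v_sq, ← pow_mul,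
      ← zpow_natCast (v k) (2 * n), div_eq_inv_mul, ← zpow_neg, ← mul_assoc,
      ← zpow_add₀ hv]
    congr 2
    push_cast
    ring
  by_cases hL : ∀ l : L.obj, (ε : k[ε]) • l = 0
  · have h2 : (⟦FGModuleCat.of k[ε] (k[ε] × (nS k (n - 1)).obj)⟧ : IsoClass k) ≠ ⟦L⟧ := by
      intro h
      obtain ⟨e⟩ := (mk_eq_mk_iff _ _).1 h
      have e' : (k[ε] × (nS k (n - 1)).obj) ≃ₗ[k[ε]] L.obj := e
      have h1 : (ε : k[ε]) • ((1, 0) : k[ε] × (nS k (n - 1)).obj) = 0 :=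
        e'.injective (by rw [map_smul, hL, map_zero])
      simpa using congrArg TrivSqZeroExt.snd (congrArg Prod.fst h1)
    rw [if_neg h2, mul_zero, add_zero]
    split_ifs with h
    · obtain ⟨e⟩ := (mk_eq_mk_iff _ _).1 h
      obtain ⟨E⟩ := exists_linearEquiv_of_card_eq (X := (nS k 1).obj × (nS k n).obj) (Y := L.obj)
        (fun y => Prod.ext (hS _) (hN _)) hL (by
          rw [Nat.card_prod, card_nS, card_nS, ← Nat.card_congr e.toEquiv,
            card_nS, pow_one, pow_succ'])
      have x : ExactPair k[ε] (nS k 1).obj (nS k n).obj L.obj :=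
        ⟨(E.toLinearMap ∘ₗ LinearMap.inr _ _ _, LinearMap.fst _ _ _ ∘ₗ E.symm.toLinearMap),
          E.injective.comp LinearMap.inr_injective,
          Prod.fst_surjective.comp E.symm.surjective, fun l => by
            obtain ⟨⟨c, m⟩, rfl⟩ := E.surjective l
            change (E.symm (E (c, m))).1 = 0 ↔ ∃ y, E (0, y) = E (c, m)
            simp [eq_comm]⟩
      rw [hconst, card_extMiddle_of_eps_trivial hL x, Nat.cast_one]
    · rw [mul_zero]
      refine structConst_eq_zero ⟨fun x => h ((mk_eq_mk_iff _ _).2 ?_)⟩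
      refine exists_linearEquiv_of_card_eq (eps_smul_nS _) hL ?_
      rw [card_of_exactPair x, card_nS, hc, card_nS, pow_succ']
  · have h1 : (⟦nS k (n + 1)⟧ : IsoClass k) ≠ ⟦L⟧ := by
      intro h
      obtain ⟨e⟩ := (mk_eq_mk_iff _ _).1 h
      refine hL fun l => e.symm.injective ?_
      rw [map_smul, eps_smul_nS, map_zero]
    rw [if_neg h1, mul_zero, zero_add]
    push Not at hL
    obtain ⟨l, hl⟩ := hL
    rcases n with _ | n
    -- For `n = 0` the map `L → S` is injective, so `ε` kills `L` after all.
    · rw [Nat.cast_zero, neg_zero, sub_self, zero_mul]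
      refine structConst_eq_zero ⟨fun x => hl ?_⟩
      have : Subsingleton (nS k 0).obj := inferInstanceAs (Subsingleton (Fin 0 → _))
      obtain ⟨m, hm⟩ := (x.2.2.2 ((ε : k[ε]) • l)).1 (by rw [map_smul, hS])
      rw [← hm, Subsingleton.elim m 0, map_zero]
    rw [Nat.add_sub_cancel] at hP ⊢
    have hcard : Nat.card (nS k (n + 1)).obj = Nat.card k * Nat.card (nS k n).obj := by
      rw [card_nS, card_nS, pow_succ']
    split_ifs with h
    · have h3 := card_extMiddle_prod (S := (nS k 1).obj) (N := (nS k (n + 1)).obj)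
        (P := (nS k n).obj) hS hc hN hP hcard
      rw [card_nS] at h3
      have h4 := congrArg (Nat.cast (R := QV k)) h3
      rw [Nat.cast_add, Nat.cast_one, Nat.cast_pow, ← v_sq, ← pow_mul, ← eq_sub_iff_add_eq] at h4
      rw [← structConst_congr rfl rfl h, hconst, mul_one]
      refine (congrArg (v k ^ (-((n + 1 : ℕ) : ℤ)) * ·) h4).trans ?_
      rw [mul_sub, mul_one, ← zpow_natCast, ← zpow_add₀ hv]
      congr 2
      push_cast
      ring
    · rw [mul_zero]
      refine structConst_eq_zero ⟨fun x => h ((mk_eq_mk_iff _ _).2 ?_)⟩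
      obtain ⟨e⟩ := nonempty_linearEquiv_prod (S := (nS k 1).obj) (N := (nS k (n + 1)).obj)
        (P := (nS k n).obj) hc hN hP hcard x hl
      exact ⟨e.symm⟩

namespace HallAlgebra

open Classical in
theorem cls_apply (M L : FGModuleCat.{u} k[ε]) :
    coord L (cls M) = if (⟦M⟧ : IsoClass k) = ⟦L⟧ then 1 else 0 :=
  Finsupp.single_apply

theorem ext_coord {x y : HallAlgebra k} (h : ∀ L, coord L x = coord L y) : x = y :=
  Finsupp.ext fun c => by
    induction c using Quotient.inductionOn with
    | h L => exact h L

theorem cls_bbK_mul (M : FGModuleCat.{u} k[ε]) :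
    cls (bbK k) * cls M = cls (FGModuleCat.of k[ε] (k[ε] × M.obj)) :=
  ext_coord fun L => by rw [coord_cls_mul_cls, structConst_bbK, cls_apply]

theorem commute_cls_bbK (x : HallAlgebra k) : Commute x (cls (bbK k)) := by
  have : Projective (bbK k).obj :=
    (IsProjective.iff_projective (R := k[ε]) (P := k[ε])).1 inferInstance
  have : HasProjectiveDimensionLT (bbK k).obj 1 := inferInstance
  exact (cls_commute _ (hasProjectiveDimensionLT_of_ge _ 1 2 (by norm_num)) x).symm

/-- The two-term rule that drives the recursion, obtained by comparing coordinates. Centrality of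
`[𝕂]` lets `[(n-1)S] * [𝕂]` be read as the class of `𝕂 ⊕ (n-1)S`. -/
theorem cls_nS_mul (n : ℕ) : cls (nS k 1) * cls (nS k n) =
    v k ^ (-(n : ℤ)) • cls (nS k (n + 1)) +
      (v k ^ (n : ℤ) - v k ^ (-(n : ℤ))) • (cls (nS k (n - 1)) * cls (bbK k)) := by
  rw [(commute_cls_bbK _).eq, cls_bbK_mul]
  refine ext_coord fun L => ?_
  rw [coord_cls_mul_cls, structConst_nS, map_add, map_smul, map_smul, cls_apply, cls_apply,
    smul_eq_mul, smul_eq_mul]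

theorem cls_nS_zero : cls (nS k 0) = 1 := by
  have : Subsingleton (nS k 0).obj := inferInstanceAs (Subsingleton (Fin 0 → _))
  rw [one_def, cls]
  refine congrArg basis ((mk_eq_mk_iff _ _).2 ⟨?_⟩)
  exact (default : (nS k 0).obj ≃ₗ[k[ε]] PUnit.{u + 1})

end HallAlgebra

variable (k) in
/-- The canonical map from the twisted Hall algebra to the `ı`Hall algebra. -/
noncomputable def toIHall : HallAlgebra k →+* IHallAlgebra k :=
  OreLocalization.numeratorRingHom.comp (toQuotient (k := k)).toRingHom

theorem toIHall_cls (M : FGModuleCat.{u} k[ε]) : toIHall k (HallAlgebra.cls M) = cls M := rfl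

theorem toIHall_smul (c : QV k) (x : HallAlgebra k) : toIHall k (c • x) = c • toIHall k x := by
  change OreLocalization.numeratorHom (S := denominators k) (toQuotient (c • x)) =
    c • OreLocalization.numeratorHom (S := denominators k) (toQuotient x)
  rw [map_smul]
  exact (OreLocalization.smul_oreDiv_one c (toQuotient x)).symm

theorem cls_nS_mul (n : ℕ) : cls (nS k 1) * cls (nS k n) =
    v k ^ (-(n : ℤ)) • cls (nS k (n + 1)) +
      (v k ^ (n : ℤ) - v k ^ (-(n : ℤ))) • (cls (nS k (n - 1)) * cls (bbK k)) := by
  simp only [← toIHall_cls, ← map_mul, ← toIHall_smul, ← map_add]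
  rw [HallAlgebra.cls_nS_mul]

theorem cls_nS_zero : cls (nS k 0) = 1 := by
  rw [← toIHall_cls, HallAlgebra.cls_nS_zero, map_one]

theorem commute_cls_bbK (M : FGModuleCat.{u} k[ε]) : Commute (cls M) (cls (bbK k)) :=
  (HallAlgebra.commute_cls_bbK (HallAlgebra.cls M)).map (toIHall k)

/-! ### The `ı`divided powers as sums -/

variable (k) in
-- The sign `σ = -(-1) ^ n` is `-1` for even `n` and `1` for odd `n`, which selects the two claims
-- of `prod_eq_divSum_even`.
theorem iDivPowEven_eq (n : ℕ) : iDivPowEven k n =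
    (qFact k n)⁻¹ • divSum k (fun m => cls (nS k m)) (cls (bbK k)) (-(-1) ^ n) n := by
  rw [iDivPowEven]
  congr 1
  obtain ⟨m, rfl | rfl⟩ := n.even_or_odd'
  · have h := (prod_eq_divSum_even (x := fun m => cls (nS k m)) (K := cls (bbK k)) cls_nS_mul
      cls_nS_zero (commute_cls_bbK _) m).1
    rw [(even_two_mul m).neg_one_pow, ← h, Nat.mul_mod_right, pow_zero, one_mul,
      Nat.mul_div_cancel_left m two_pos]
    rfl
  · have h := (prod_eq_divSum_even (x := fun m => cls (nS k m)) (K := cls (bbK k)) cls_nS_mul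
      cls_nS_zero (commute_cls_bbK _) m).2
    rw [(odd_two_mul_add_one m).neg_one_pow, neg_neg, ← h, show (2 * m + 1) % 2 = 1 by omega,
      pow_one, show (2 * m + 1) / 2 = m by omega]
    rfl

variable (k) in
theorem iDivPowOdd_eq (n : ℕ) : iDivPowOdd k n =
    (qFact k n)⁻¹ • divSum k (fun m => cls (nS k m)) (cls (bbK k)) ((-1) ^ n) n := by
  rw [iDivPowOdd]
  congr 1
  obtain ⟨m, rfl | rfl⟩ := n.even_or_odd'
  · have h := prod_eq_divSum_odd (x := fun m => cls (nS k m)) (K := cls (bbK k)) cls_nS_mul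
      cls_nS_zero (commute_cls_bbK _) m
    rw [(even_two_mul m).neg_one_pow, ← h, Nat.mul_mod_right, pow_zero, one_mul,
      Nat.mul_div_cancel_left m two_pos]
    rfl
  · have h := prod_eq_divSum_odd (x := fun m => cls (nS k m)) (K := cls (bbK k)) cls_nS_mul
      cls_nS_zero (commute_cls_bbK _) m
    -- For odd `n` the sign is `-1`, and the recursion splits off the leading `[S]`, which leaves
    -- the even case.
    rw [(odd_two_mul_add_one m).neg_one_pow, divSum_neg_one_succ cls_nS_mul, ← h,
      show (2 * m + 1) % 2 = 1 by omega, pow_one, show (2 * m + 1) / 2 = m by omega]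
    rfl

end Products

end IHall

theorem proposition6p4 {k : Type*} [Field k] [Finite k] (n : ℕ) :
    (IHall.iDivPowEven k n = ∑ j ∈ Finset.range (n / 2 + 1),
      (IHall.v k ^ ((j : ℤ) * ((j : ℤ) - (-1) ^ n) - ((n - 2 * j).choose 2 : ℕ)) *
        (IHall.v k - (IHall.v k)⁻¹) ^ j / (IHall.qFact k (n - 2 * j) * IHall.qDoubleFact k j)) •
        (IHall.cls (IHall.nS k (n - 2 * j)) * IHall.cls (IHall.bbK k) ^ j)) ∧
    (IHall.iDivPowOdd k n = ∑ j ∈ Finset.range (n / 2 + 1),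
      (IHall.v k ^ ((j : ℤ) * ((j : ℤ) + (-1) ^ n) - ((n - 2 * j).choose 2 : ℕ)) *
        (IHall.v k - (IHall.v k)⁻¹) ^ j / (IHall.qFact k (n - 2 * j) * IHall.qDoubleFact k j)) •
        (IHall.cls (IHall.nS k (n - 2 * j)) * IHall.cls (IHall.bbK k) ^ j)) := by
  refine ⟨?_, ?_⟩
  · rw [IHall.iDivPowEven_eq, IHall.inv_smul_divSum]
    simp only [← sub_eq_add_neg]
  · rw [IHall.iDivPowOdd_eq, IHall.inv_smul_divSum]
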